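/- Let $0<\alpha<1$. There is a constant $c$, depending only on $\alpha$, with the following property. Let $d\in\{1,2,3\}$, let $\Omega\subset\mathbb R^d$ be a bounded convex polygonal (polyhedral) domain, and let $\mathcal T_h$ be any conforming triangulation of $\Omega$ into finitely many $d$-simplices. Let $X_h=\{\chi\in H^1_0(\Omega):\chi|_K\text{ is affine for all }K\in\mathcal T_h\}$, let $P_h:L^2(\Omega)\to X_h$ be the $L^2(\Omega)$-orthogonal projection, and let $A_h:X_h\to X_h$ be defined by $(A_h\varphi,\chi)=(\nabla\varphi,\nabla\chi)$ for all $\varphi,\chi\in X_h$, where $(\cdot,\cdot)$ is the $L^2(\Omega)$-inner product. Let $T>0$, $N\ge 1$ an integer, $\tau=T/N$, $t_n=n\tau$ and $v\in L^2(\Omega)$. Put $b_j=\bigl((j+1)^{1-\alpha}-j^{1-\alpha}\bigr)/\Gamma(2-\alpha)$, and let $U_h^0=P_hv$ and $U_h^1,\dots,U_h^N\in X_h$ solve the L1 time-stepping scheme with $f\equiv0$, $$(b_0I+\tau^\alpha A_h)U_h^n=b_{n-1}U_h^0+\sum_{j=1}^{n-1}(b_{j-1}-b_j)U_h^{n-j},\qquad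 n=1,\dots,N .$$ (i) Error bound: if $u_h:[0,T]\to X_h$ is the solution of the spatially semidiscrete problem $\partial_t^\alpha u_h(t)+A_hu_h(t)=0$ for $0<t\le T$, $u_h(0)=P_hv$, where $\partial_t^\alpha u(t)=\frac1{\Gamma(1-\alpha)}\int_0^t(t-s)^{-\alpha}u'(s)\,ds$ is the Caputo derivative (here $u_h$ is continuous on $[0,T]$, differentiable on $(0,T)$, and $s\mapsto(t-s)^{-\alpha}u_h'(s)$ is integrable on $(0,t)$ for every $0<t\le T$), then $$\|u_h(t_n)-U_h^n\|_{L^2(\Omega)}\le c\,\tau\,t_n^{-1}\,\|v\|_{L^2(\Omega)},\qquad n=1,\dots,N .$$ (ii) $L^2$-stability of the L1 scheme: $\|U_h^n\|_{L^2(\Omega)}\le c\,\|v\|_{L^2(\Omega)}$ for $n=0,1,\dots,N$. In particular, $c$ does not depend on the mesh size $h$ or on the time step size $\tau$. -/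

import Mathlib

open MeasureTheory Set
open scoped ContDiff InnerProductSpace

noncomputable section

namespace L1Scheme

variable {d : ℕ}

/-- Bounded convex polygonal (polyhedral) domains: the nonempty interiors of convex polytopes. -/
def IsConvexPolygonalDomain (Ω : Set (EuclideanSpace ℝ (Fin d))) : Prop :=
  Ω.Nonempty ∧ ∃ S : Set (EuclideanSpace ℝ (Fin d)), S.Finite ∧ Ω = interior (convexHull ℝ S)

/-- The space `L²(Ω)` of real-valued functions. -/
abbrev L2 (Ω : Set (EuclideanSpace ℝ (Fin d))) :=
  Lp ℝ 2 (volume.restrict Ω)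

/-- The space `L²(Ω; ℝᵈ)` of vector fields. -/
abbrev L2Vec (Ω : Set (EuclideanSpace ℝ (Fin d))) :=
  Lp (EuclideanSpace ℝ (Fin d)) 2 (volume.restrict Ω)

theorem gradient_eq_symm (φ : EuclideanSpace ℝ (Fin d) → ℝ) (x : EuclideanSpace ℝ (Fin d)) :
    gradient φ x = (InnerProductSpace.toDual ℝ (EuclideanSpace ℝ (Fin d))).symm (fderiv ℝ φ x) :=
  rfl

/-- The graph of the classical gradient on the test functions `C_c^∞(Ω)`, as a subspace of
`L²(Ω) × L²(Ω; ℝᵈ)`. -/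
def testGradGraph (Ω : Set (EuclideanSpace ℝ (Fin d))) : Submodule ℝ (L2 Ω × L2Vec Ω) where
  carrier := {p | ∃ φ : EuclideanSpace ℝ (Fin d) → ℝ, ContDiff ℝ ∞ φ ∧ HasCompactSupport φ ∧
    tsupport φ ⊆ Ω ∧ p.1 =ᵐ[volume.restrict Ω] φ ∧ p.2 =ᵐ[volume.restrict Ω] gradient φ}
  zero_mem' := by
    refine ⟨fun _ => 0, contDiff_const, HasCompactSupport.zero, by simp [tsupport], ?_, ?_⟩
    · exact Lp.coeFn_zero _ _ _
    · have h : gradient (fun _ : EuclideanSpace ℝ (Fin d) => (0 : ℝ)) = 0 := by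
        funext x; simp
      rw [h]; exact Lp.coeFn_zero _ _ _
  add_mem' := by
    rintro p q ⟨φ, h1, h2, h3, h4, h5⟩ ⟨ψ, k1, k2, k3, k4, k5⟩
    refine ⟨φ + ψ, h1.add k1, h2.add k2,
      (tsupport_add φ ψ).trans (union_subset h3 k3), ?_, ?_⟩
    · exact (Lp.coeFn_add _ _).trans (h4.add k4)
    · refine (Lp.coeFn_add _ _).trans ((h5.add k5).trans (Filter.Eventually.of_forall fun x => ?_))
      simp only [Pi.add_apply, gradient_eq_symm]
      rw [fderiv_add (h1.differentiable (by simp) x) (k1.differentiable (by simp) x), map_add]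
  smul_mem' := by
    rintro c p ⟨φ, h1, h2, h3, h4, h5⟩
    refine ⟨c • φ, h1.const_smul c, h2.smul_left (f := fun _ => c),
      (closure_mono (Function.support_const_smul_subset c φ)).trans h3, ?_, ?_⟩
    · exact (Lp.coeFn_smul _ _).trans (h4.const_smul c)
    · refine (Lp.coeFn_smul _ _).trans ((h5.const_smul c).trans
        (Filter.Eventually.of_forall fun x => ?_))
      simp only [Pi.smul_apply, gradient_eq_symm]
      rw [fderiv_const_smul (h1.differentiable (by simp) x), map_smul]

/-- The graph of the weak gradient on `H¹₀(Ω)`: the closure of the graph of the classical gradient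
on `C_c^∞(Ω)`, i.e. `H¹₀(Ω)` is the closure of `C_c^∞(Ω)` in the `H¹` norm. -/
def weakGradGraph (Ω : Set (EuclideanSpace ℝ (Fin d))) : Submodule ℝ (L2 Ω × L2Vec Ω) :=
  (testGradGraph Ω).topologicalClosure

/-- The weak gradient, a partially defined linear operator from `L²(Ω)` to `L²(Ω; ℝᵈ)` with
domain `H¹₀(Ω)`. -/
def weakGrad (Ω : Set (EuclideanSpace ℝ (Fin d))) : L2 Ω →ₗ.[ℝ] L2Vec Ω :=
  (weakGradGraph Ω).toLinearPMap

/-- The Sobolev space `H¹₀(Ω)`, as a subspace of `L²(Ω)`. -/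
def H10 (Ω : Set (EuclideanSpace ℝ (Fin d))) : Submodule ℝ (L2 Ω) :=
  (weakGrad Ω).domain

theorem weakGradGraph_functional {Ω : Set (EuclideanSpace ℝ (Fin d))} (hΩ : IsOpen Ω)
    {p : L2 Ω × L2Vec Ω} (hp : p ∈ weakGradGraph Ω) (h0 : p.1 = 0) : p.2 = 0 := by
  have key : ∀ (w : EuclideanSpace ℝ (Fin d)) (ψ : EuclideanSpace ℝ (Fin d) → ℝ),
      ContDiff ℝ ∞ ψ → HasCompactSupport ψ → tsupport ψ ⊆ Ω →
      ∫ x, ψ x • ⟪w, p.2 x⟫_ℝ ∂(volume.restrict Ω) = 0 := by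
    intro w ψ h1 h2 h3
    have c1 : Continuous fun x => fderiv ℝ ψ x w :=
      (h1.continuous_fderiv (by simp)).clm_apply continuous_const
    have s1 : HasCompactSupport fun x => fderiv ℝ ψ x w :=
      (h2.fderiv (𝕜 := ℝ)).comp_left (g := fun L : EuclideanSpace ℝ (Fin d) →L[ℝ] ℝ => L w)
        (by simp)
    have m1 : MemLp (fun x => fderiv ℝ ψ x w) 2 (volume.restrict Ω) :=
      c1.memLp_of_hasCompactSupport s1
    have c2 : Continuous fun x => ψ x • w := h1.continuous.smul continuous_const
    have s2 : HasCompactSupport fun x => ψ x • w := h2.smul_right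
    have m2 : MemLp (fun x => ψ x • w) 2 (volume.restrict Ω) :=
      c2.memLp_of_hasCompactSupport s2
    let L : (L2 Ω × L2Vec Ω) →L[ℝ] ℝ :=
      (innerSL ℝ (m1.toLp _)).comp (ContinuousLinearMap.fst ℝ _ _)
        + (innerSL ℝ (m2.toLp _)).comp (ContinuousLinearMap.snd ℝ _ _)
    have hL : ∀ q : L2 Ω × L2Vec Ω, L q =
        (∫ x, q.1 x * fderiv ℝ ψ x w ∂(volume.restrict Ω))
          + ∫ x, ψ x • ⟪w, q.2 x⟫_ℝ ∂(volume.restrict Ω) := by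
      intro q
      change ⟪m1.toLp _, q.1⟫_ℝ + ⟪m2.toLp _, q.2⟫_ℝ = _
      rw [L2.inner_def, L2.inner_def]
      congr 1
      · refine integral_congr_ae ?_
        filter_upwards [m1.coeFn_toLp] with x hx
        rw [hx]; simp
      · refine integral_congr_ae ?_
        filter_upwards [m2.coeFn_toLp] with x hx
        rw [hx, real_inner_smul_left]; simp
    have hker : weakGradGraph Ω ≤ LinearMap.ker L.toLinearMap := by
      refine Submodule.topologicalClosure_minimal _ ?_ L.isClosed_ker
      rintro q ⟨φ, k1, k2, k3, k4, k5⟩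
      change L q = 0
      rw [hL]
      have e1 : ∫ x, q.1 x * fderiv ℝ ψ x w ∂(volume.restrict Ω) =
          ∫ x, φ x * fderiv ℝ ψ x w := by
        rw [integral_congr_ae (g := fun x => φ x * fderiv ℝ ψ x w)
          (by filter_upwards [k4] with x hx; rw [hx])]
        refine setIntegral_eq_integral_of_forall_compl_eq_zero fun x hx => ?_
        rw [image_eq_zero_of_notMem_tsupport fun h => hx (k3 h), zero_mul]
      have e2 : ∫ x, ψ x • ⟪w, q.2 x⟫_ℝ ∂(volume.restrict Ω) =
          ∫ x, fderiv ℝ φ x w * ψ x := by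
        rw [integral_congr_ae (g := fun x => fderiv ℝ φ x w * ψ x)
          (by
            filter_upwards [k5] with x hx
            rw [hx, gradient_eq_symm, real_inner_comm, InnerProductSpace.toDual_symm_apply,
              smul_eq_mul, mul_comm])]
        refine setIntegral_eq_integral_of_forall_compl_eq_zero fun x hx => ?_
        rw [image_eq_zero_of_notMem_tsupport fun h => hx (h3 h), mul_zero]
      have c3 : Continuous fun x => fderiv ℝ φ x w :=
        (k1.continuous_fderiv (by simp)).clm_apply continuous_const
      rw [e1, e2, integral_mul_fderiv_eq_neg_fderiv_mul_of_integrable, neg_add_cancel]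
      · exact (c3.mul h1.continuous).integrable_of_hasCompactSupport h2.mul_left
      · exact (k1.continuous.mul c1).integrable_of_hasCompactSupport k2.mul_right
      · exact (k1.continuous.mul h1.continuous).integrable_of_hasCompactSupport k2.mul_right
      · exact fun x _ => k1.differentiable (by simp) x
      · exact fun x _ => h1.differentiable (by simp) x
    have h := hker hp
    change L p = 0 at h
    rw [hL, h0, integral_congr_ae (g := fun _ => (0 : ℝ))
      (by filter_upwards [Lp.coeFn_zero ℝ 2 (volume.restrict Ω)] with x hx; rw [hx]; simp)] at h
    simpa using h
  have hz : ∀ i : Fin d, ∀ᵐ x ∂(volume.restrict Ω), p.2 x i = 0 := by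
    intro i
    have hm : MemLp (fun x => ⟪EuclideanSpace.single i (1 : ℝ), p.2 x⟫_ℝ) 2
        (volume.restrict Ω) := (Lp.memLp p.2).const_inner _
    have := hΩ.ae_eq_zero_of_integral_contDiff_smul_eq_zero
      (f := fun x => ⟪EuclideanSpace.single i (1 : ℝ), p.2 x⟫_ℝ) (μ := volume)
      ((locallyIntegrableOn_of_locallyIntegrable_restrict
        (hm.locallyIntegrable (by norm_num)))) (fun ψ a b c => by
          rw [← key (EuclideanSpace.single i (1 : ℝ)) ψ a b c]
          symm
          refine setIntegral_eq_integral_of_forall_compl_eq_zero fun x hx => ?_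
          rw [image_eq_zero_of_notMem_tsupport fun h => hx (c h), zero_smul])
    rw [ae_restrict_iff' hΩ.measurableSet]
    filter_upwards [this] with x hx hxΩ
    simpa [EuclideanSpace.inner_single_left] using hx hxΩ
  apply Lp.ext
  filter_upwards [ae_all_iff.2 hz, Lp.coeFn_zero (EuclideanSpace ℝ (Fin d)) 2 (volume.restrict Ω)]
    with x hx h0
  rw [h0]
  ext i
  simpa using hx i

/-- On an open set, `weakGrad Ω` is the operator with graph `weakGradGraph Ω`. -/
theorem weakGrad_graph {Ω : Set (EuclideanSpace ℝ (Fin d))} (hΩ : IsOpen Ω) :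
    (weakGrad Ω).graph = weakGradGraph Ω :=
  (weakGradGraph Ω).toLinearPMap_graph_eq fun _ hp h0 => weakGradGraph_functional hΩ hp h0

/-- A (conforming) triangulation of `Ω`: a finite simplicial complex which fills the closure of `Ω`
and in which every face is a face of some `d`-simplex. -/
structure Triangulation (Ω : Set (EuclideanSpace ℝ (Fin d))) extends
    Geometry.SimplicialComplex ℝ (EuclideanSpace ℝ (Fin d)) where
  finite_faces : faces.Finite
  space_eq : toSimplicialComplex.space = closure Ω
  pure : ∀ s ∈ faces, ∃ t ∈ faces, s ⊆ t ∧ t.card = d + 1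

/-- The vertex sets of the `d`-simplices (elements) of the triangulation. -/
def Triangulation.elements {Ω : Set (EuclideanSpace ℝ (Fin d))} (𝒯 : Triangulation Ω) :
    Set (Finset (EuclideanSpace ℝ (Fin d))) :=
  {s | s ∈ 𝒯.faces ∧ s.card = d + 1}

/-- The pairs of an `L²` function `v` and a choice, for every element, of an affine function
`x ↦ ⟪a, x⟫ + c` that agrees with `v` on that element. -/
def affinePieces {Ω : Set (EuclideanSpace ℝ (Fin d))} (𝒯 : Triangulation Ω) :
    Submodule ℝ (L2 Ω × (𝒯.elements → EuclideanSpace ℝ (Fin d) × ℝ)) where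
  carrier := {p | ∀ s : 𝒯.elements, ∀ᵐ x ∂(volume.restrict Ω),
    x ∈ convexHull ℝ (s.1 : Set (EuclideanSpace ℝ (Fin d))) → p.1 x = ⟪(p.2 s).1, x⟫_ℝ + (p.2 s).2}
  zero_mem' := by
    intro s
    filter_upwards [Lp.coeFn_zero ℝ 2 (volume.restrict Ω)] with x hx _
    change (0 : L2 Ω) x = ⟪(0 : EuclideanSpace ℝ (Fin d)), x⟫_ℝ + 0
    rw [hx]; simp
  add_mem' := by
    intro p q hp hq s
    filter_upwards [hp s, hq s, Lp.coeFn_add p.1 q.1] with x h1 h2 h3 hx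
    simp only [Prod.fst_add, Prod.snd_add, Pi.add_apply, inner_add_left] at *
    rw [h3, h1 hx, h2 hx]; ring
  smul_mem' := by
    intro c p hp s
    filter_upwards [hp s, Lp.coeFn_smul c p.1] with x h1 h3 hx
    simp only [Prod.smul_fst, Prod.smul_snd, Pi.smul_apply, real_inner_smul_left,
      smul_eq_mul] at *
    rw [h3, h1 hx]; ring

/-- The space `X_h` of the continuous piecewise linear finite elements: the functions in `H¹₀(Ω)`
whose restriction to every element of the triangulation is affine. -/
def feSpace {Ω : Set (EuclideanSpace ℝ (Fin d))} (𝒯 : Triangulation Ω) : Submodule ℝ (L2 Ω) :=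
  H10 Ω ⊓ (affinePieces 𝒯).map (LinearMap.fst ℝ _ _)

theorem mem_feSpace {Ω : Set (EuclideanSpace ℝ (Fin d))} {𝒯 : Triangulation Ω} {v : L2 Ω} :
    v ∈ feSpace 𝒯 ↔ v ∈ H10 Ω ∧ ∀ s ∈ 𝒯.elements,
      ∃ (a : EuclideanSpace ℝ (Fin d)) (c : ℝ), ∀ᵐ x ∂(volume.restrict Ω),
        x ∈ convexHull ℝ (s : Set (EuclideanSpace ℝ (Fin d))) → v x = ⟪a, x⟫_ℝ + c := by
  rw [feSpace, Submodule.mem_inf]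
  refine and_congr_right fun _ => ⟨?_, fun h => ?_⟩
  · rintro ⟨p, hp, rfl⟩ s hs
    exact ⟨_, _, hp ⟨s, hs⟩⟩
  · choose a c hac using h
    exact ⟨(v, fun s => (a s.1 s.2, c s.1 s.2)), fun s => hac s.1 s.2, rfl⟩

theorem affinePieces_finite {Ω : Set (EuclideanSpace ℝ (Fin d))} (𝒯 : Triangulation Ω) :
    FiniteDimensional ℝ (affinePieces 𝒯) := by
  have hfin : 𝒯.elements.Finite := 𝒯.finite_faces.subset fun s hs => hs.1
  have : Finite 𝒯.elements := hfin.to_subtype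
  let π := (LinearMap.snd ℝ (L2 Ω) (𝒯.elements → EuclideanSpace ℝ (Fin d) × ℝ)).comp
    (affinePieces 𝒯).subtype
  have hπ : Function.Injective π := by
    rw [← LinearMap.ker_eq_bot, LinearMap.ker_eq_bot']
    rintro ⟨p, hp⟩ h0
    change p.2 = 0 at h0
    have hcov : ∀ x ∈ closure Ω, ∃ s : 𝒯.elements,
        x ∈ convexHull ℝ (s.1 : Set (EuclideanSpace ℝ (Fin d))) := by
      intro x hx
      rw [← 𝒯.space_eq, Geometry.SimplicialComplex.mem_space_iff] at hx
      obtain ⟨s, hs, hxs⟩ := hx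
      obtain ⟨t, ht, hst, hc⟩ := 𝒯.pure s hs
      exact ⟨⟨t, ht, hc⟩, convexHull_mono (by exact_mod_cast hst) hxs⟩
    have hcov' : ∀ᵐ x ∂(volume.restrict Ω), x ∈ closure Ω :=
      ae_mono (Measure.restrict_mono subset_closure le_rfl)
        (ae_restrict_mem isClosed_closure.measurableSet)
    refine Subtype.ext (Prod.ext (Lp.ext ?_) h0)
    filter_upwards [ae_all_iff.2 hp, hcov', Lp.coeFn_zero ℝ 2 (volume.restrict Ω)] with x hx hΩ hz
    obtain ⟨s, hs⟩ := hcov x hΩ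
    change p.1 x = (0 : L2 Ω) x
    rw [hx s hs, hz, h0]; simp
  exact FiniteDimensional.of_injective π hπ

instance feSpace_finite {Ω : Set (EuclideanSpace ℝ (Fin d))} (𝒯 : Triangulation Ω) :
    FiniteDimensional ℝ (feSpace 𝒯) := by
  have := affinePieces_finite 𝒯
  exact Submodule.finiteDimensional_of_le (inf_le_right : feSpace 𝒯 ≤ _)

/-- The `L²(Ω)`-orthogonal projection `P_h : L²(Ω) → X_h`. -/
def projL2 {Ω : Set (EuclideanSpace ℝ (Fin d))} (𝒯 : Triangulation Ω) :
    L2 Ω →L[ℝ] feSpace 𝒯 :=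
  (feSpace 𝒯).orthogonalProjectionOnto

/-- The weak gradient on `X_h`. -/
def feGrad {Ω : Set (EuclideanSpace ℝ (Fin d))} (𝒯 : Triangulation Ω) :
    feSpace 𝒯 →L[ℝ] L2Vec Ω :=
  LinearMap.toContinuousLinearMap
    ((weakGrad Ω).toFun.comp (Submodule.inclusion (inf_le_left : feSpace 𝒯 ≤ H10 Ω)))

/-- The operator `A_h = -Δ_h` on `X_h`, where `Δ_h` is the discrete Laplacian; see
`inner_discreteNegLaplacian`. -/
def discreteNegLaplacian {Ω : Set (EuclideanSpace ℝ (Fin d))} (𝒯 : Triangulation Ω) :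
    feSpace 𝒯 →L[ℝ] feSpace 𝒯 :=
  (ContinuousLinearMap.adjoint (feGrad 𝒯)).comp (feGrad 𝒯)

/-- `(A_h φ, χ) = (∇φ, ∇χ)` for all `φ, χ ∈ X_h`. -/
theorem inner_discreteNegLaplacian {Ω : Set (EuclideanSpace ℝ (Fin d))} (𝒯 : Triangulation Ω)
    (φ χ : feSpace 𝒯) :
    ⟪discreteNegLaplacian 𝒯 φ, χ⟫_ℝ = ⟪feGrad 𝒯 φ, feGrad 𝒯 χ⟫_ℝ := by
  rw [discreteNegLaplacian, ContinuousLinearMap.comp_apply]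
  exact ContinuousLinearMap.adjoint_inner_left (feGrad 𝒯) χ (feGrad 𝒯 φ)

/-- The left-sided Caputo derivative
`(∂ₜ^α u)(t) = Γ(1 - α)⁻¹ ∫₀ᵗ (t - s)^(-α) u'(s) ds`. -/
def caputoDeriv {X : Type*} [NormedAddCommGroup X] [NormedSpace ℝ X] (α : ℝ) (u : ℝ → X)
    (t : ℝ) : X :=
  (Real.Gamma (1 - α))⁻¹ • ∫ s in (0 : ℝ)..t, (t - s) ^ (-α) • deriv u s

/-- `u : [0, T] → X_h` solves the spatially semidiscrete problem
`∂ₜ^α u + A_h u = P_h f` on `(0, T]`, `u(0) = v_h`. -/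
structure IsSemidiscreteSolution {Ω : Set (EuclideanSpace ℝ (Fin d))} (𝒯 : Triangulation Ω)
    (α T : ℝ) (f : ℝ → L2 Ω) (vh : feSpace 𝒯) (u : ℝ → feSpace 𝒯) : Prop where
  continuousOn : ContinuousOn u (Icc 0 T)
  differentiableOn : DifferentiableOn ℝ u (Ioo 0 T)
  integrable : ∀ t ∈ Ioc 0 T,
    IntervalIntegrable (fun s => (t - s) ^ (-α) • deriv u s) volume 0 t
  equation : ∀ t ∈ Ioc 0 T,
    caputoDeriv α u t + discreteNegLaplacian 𝒯 (u t) = projL2 𝒯 (f t)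
  initial : u 0 = vh

/-- The weights `b_j = ((j + 1)^(1 - α) - j^(1 - α)) / Γ(2 - α)` of the L1 scheme. -/
def weight (α : ℝ) (j : ℕ) : ℝ :=
  (((j : ℝ) + 1) ^ (1 - α) - (j : ℝ) ^ (1 - α)) / Real.Gamma (2 - α)

/-- `U^0, …, U^N ∈ X_h` solve the L1 time-stepping scheme with step size `τ`: `U^0 = v_h` and
`(b_0 I + τ^α A_h) U^n = b_{n-1} U^0 + ∑_{j=1}^{n-1} (b_{j-1} - b_j) U^{n-j} + τ^α P_h f(t_n)`
for `n = 1, …, N`. -/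
structure IsL1Solution {Ω : Set (EuclideanSpace ℝ (Fin d))} (𝒯 : Triangulation Ω)
    (α τ : ℝ) (N : ℕ) (f : ℝ → L2 Ω) (vh : feSpace 𝒯) (U : ℕ → feSpace 𝒯) : Prop where
  initial : U 0 = vh
  step : ∀ n : ℕ, 1 ≤ n → n ≤ N →
    weight α 0 • U n + τ ^ α • discreteNegLaplacian 𝒯 (U n) =
      weight α (n - 1) • U 0
        + ∑ j ∈ Finset.Icc 1 (n - 1), (weight α (j - 1) - weight α j) • U (n - j)
        + τ ^ α • projL2 𝒯 (f (n * τ))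

end L1Scheme

end

/-!
The operator `A_h` is symmetric and nonnegative, so both problems split into scalar problems for its
eigenvalues `λ ≥ 0`, and `P_h` is a contraction. It remains to bound the scalar error by `c / n`
and the scalar L1 solution by its initial value, uniformly in `λ` and `τ`; in rescaled time the step
size is `1` and the only parameter is `μ = λ τ^α`.

Let `b_j` be the weights of the scheme. Summed over the time levels, the scheme reads
`∑ᵢ (b_{n-i} + μ) U^{i+1} = U⁰ ∑ᵢ b_i`. The sequence `a_j = b_j + μ` is positive, decreasing and
log-convex, so by Kaluza's theorem (`recipSeq_succ_nonpos`) the reciprocal of its generating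
function has nonpositive coefficients after the first. Hence the partial sums `K_n` of that reciprocal
are nonnegative and decreasing, with `μ ∑ K_n ≤ 1`, and `U^n = U⁰ (1 - μ ∑_{j<n} K_j)` is,
for `U⁰ ≥ 0`, decreasing, convex and contained in `[0, U⁰]`. This gives stability.

For a scalar solution `w`, where `w(0) ≥ 0` without loss of generality, the Caputo equation
integrated in time is a Volterra equation in which only `w` itself appears (`isIntegratedSol_of_caputo`), with the kernel `k(x) = x^(-α) / Γ(1 - α)` for which
`b_j = ∫₀¹ k(j + x) dx`. It yields an exact formula for the error (`error_eq`). The formula is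
used twice.

* With the step size refined to `1 / m`, and only knowing that `w` has bounded variation, it shows
  that the L1 solutions converge to `w` (`tendsto_discreteSol`). Therefore `w` inherits
  monotonicity and convexity from the discrete solutions, and `w(0) - w(1) = O(μ)`.
* With unit step size, it expresses the error through `K * q` and the differences of `φ`, where
  `q_j = k(j + x) - b_j` and `φ_i = w(i + 1 - x) - w(i + 1)`. Convexity makes `φ` decreasing with
  `∑ φ_i ≤ w(0)`, while `μ (m + 1) |(K * q)_m|` is bounded; splitting the factor `n + 1` between the
  two factors of each convolution bounds `n + 1` times the error (`mul_abs_recip_conv_le`,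
  `mul_abs_error_le`). No pointwise bound for derivatives of `w` is needed.
-/

noncomputable section

namespace L1Scheme

/-! ### Reciprocals of log-convex sequences -/

/-- The coefficients of the reciprocal `1 / ∑ aₙ zⁿ` of a generating function. -/
def recipSeq (a : ℕ → ℝ) (n : ℕ) : ℝ :=
  PowerSeries.coeff n (PowerSeries.mk a)⁻¹

/-- The coefficients of `1 / ((1 - z) ∑ aₙ zⁿ)`, i.e. the partial sums of `recipSeq a`. -/
def resolventSeq (a : ℕ → ℝ) (n : ℕ) : ℝ :=
  ∑ i ∈ Finset.range (n + 1), recipSeq a i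

theorem mk_mul_recipSeq {a : ℕ → ℝ} (ha : a 0 ≠ 0) :
    PowerSeries.mk a * PowerSeries.mk (recipSeq a) = 1 := by
  have : PowerSeries.mk (recipSeq a) = (PowerSeries.mk a)⁻¹ := by
    ext n; simp [recipSeq]
  rw [this]
  exact PowerSeries.mul_inv_cancel _ (by simpa using ha)

theorem mk_resolventSeq (a : ℕ → ℝ) :
    PowerSeries.mk (resolventSeq a) = PowerSeries.mk (recipSeq a) * PowerSeries.mk 1 := by
  ext n
  rw [PowerSeries.coeff_mul, Finset.Nat.sum_antidiagonal_eq_sum_range_succ_mk]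
  simp [resolventSeq]

theorem mk_resolventSeq_mul_one_sub (a : ℕ → ℝ) :
    PowerSeries.mk (resolventSeq a) * (1 - PowerSeries.X) = PowerSeries.mk (recipSeq a) := by
  rw [mk_resolventSeq, mul_assoc, PowerSeries.mk_one_mul_one_sub_eq_one, mul_one]

theorem sum_mul_recipSeq {a : ℕ → ℝ} (ha : a 0 ≠ 0) (n : ℕ) :
    ∑ i ∈ Finset.range (n + 1), a (n - i) * recipSeq a i = if n = 0 then 1 else 0 := by
  have h := congrArg (PowerSeries.coeff n) (mk_mul_recipSeq ha)
  rw [mul_comm, PowerSeries.coeff_mul, Finset.Nat.sum_antidiagonal_eq_sum_range_succ_mk,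
    PowerSeries.coeff_one] at h
  rw [← h]
  refine Finset.sum_congr rfl fun i _ => ?_
  simp [mul_comm]

theorem sum_mul_resolventSeq {a : ℕ → ℝ} (ha : a 0 ≠ 0) (n : ℕ) :
    ∑ i ∈ Finset.range (n + 1), a (n - i) * resolventSeq a i = 1 := by
  have h : PowerSeries.mk (resolventSeq a) * PowerSeries.mk a = PowerSeries.mk 1 := by
    rw [mk_resolventSeq, mul_comm, ← mul_assoc, mk_mul_recipSeq ha, one_mul]
  have h := congrArg (PowerSeries.coeff n) h
  rw [PowerSeries.coeff_mul, Finset.Nat.sum_antidiagonal_eq_sum_range_succ_mk] at h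
  simpa [mul_comm] using h

theorem recipSeq_zero {a : ℕ → ℝ} : recipSeq a 0 = (a 0)⁻¹ := by
  simp [recipSeq]

/-- The ratios `a (n + 1) / a n` of a log-convex sequence increase. -/
theorem mul_le_mul_of_logConvex {a : ℕ → ℝ} (hpos : ∀ n, 0 < a n)
    (hlc : ∀ n, a (n + 1) ^ 2 ≤ a n * a (n + 2)) (j i : ℕ) :
    a (j + 1) * a (j + i) ≤ a j * a (j + i + 1) := by
  induction i with
  | zero => simp [mul_comm]
  | succ i ih =>
    have h1 := hlc (j + i)
    have h2 := hpos (j + i)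
    have h3 := hpos (j + i + 1)
    refine le_of_mul_le_mul_left ?_ h2
    calc a (j + i) * (a (j + 1) * a (j + (i + 1)))
        = (a (j + 1) * a (j + i)) * a (j + i + 1) := by rw [← add_assoc]; ring
      _ ≤ (a j * a (j + i + 1)) * a (j + i + 1) := by gcongr
      _ = a j * a (j + i + 1) ^ 2 := by ring
      _ ≤ a j * (a (j + i) * a (j + i + 2)) := by
          gcongr
          exact (hpos j).le
      _ = a (j + i) * (a j * a (j + (i + 1) + 1)) := by
          rw [show j + (i + 1) + 1 = j + i + 2 by omega]; ring

/-- **Kaluza's theorem**: the reciprocal of a power series with positive log-convex coefficients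
has nonpositive coefficients, apart from the constant one. -/
theorem recipSeq_succ_nonpos {a : ℕ → ℝ} (hpos : ∀ n, 0 < a n)
    (hlc : ∀ n, a (n + 1) ^ 2 ≤ a n * a (n + 2)) (n : ℕ) : recipSeq a (n + 1) ≤ 0 := by
  induction n using Nat.strong_induction_on with
  | _ n ih =>
  have ha0 := hpos 0
  have h1 := sum_mul_recipSeq ha0.ne' (n + 1)
  rw [Finset.sum_range_succ, Finset.sum_range_succ'] at h1
  simp only [Nat.sub_self, Nat.sub_zero, Nat.add_eq_zero_iff, one_ne_zero, and_false,
    if_false] at h1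
  refine nonpos_of_mul_nonpos_right (a := a 0) ?_ ha0
  rcases Nat.eq_zero_or_pos n with rfl | hn
  · simp only [Finset.range_zero, Finset.sum_empty, zero_add] at h1 ⊢
    have : 0 < a 1 * recipSeq a 0 := by
      rw [recipSeq_zero]; exact mul_pos (hpos 1) (inv_pos.2 ha0)
    linarith
  · have h2 := sum_mul_recipSeq ha0.ne' n
    rw [Finset.sum_range_succ', if_neg hn.ne', Nat.sub_zero] at h2
    have han := hpos n
    -- Eliminate the constant coefficient between the equations of orders `n` and `n + 1`.
    have h3 : a (n + 1) * ∑ i ∈ Finset.range n, a (n - (i + 1)) * recipSeq a (i + 1)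
        ≤ a n * ∑ i ∈ Finset.range n, a (n + 1 - (i + 1)) * recipSeq a (i + 1) := by
      rw [Finset.mul_sum, Finset.mul_sum]
      refine Finset.sum_le_sum fun i hi => ?_
      have hi := Finset.mem_range.1 hi
      have h4 := mul_le_mul_of_logConvex hpos hlc (n - (i + 1)) (i + 1)
      rw [show n - (i + 1) + (i + 1) = n by omega,
        show n - (i + 1) + 1 = n + 1 - (i + 1) by omega] at h4
      nlinarith [ih i hi]
    have h5 : a n * (a 0 * recipSeq a (n + 1)) ≤ 0 := by
      have e1 := congrArg (a (n + 1) * ·) h2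
      have e2 := congrArg (a n * ·) h1
      simp only [mul_add, mul_zero] at e1 e2
      nlinarith
    exact nonpos_of_mul_nonpos_right h5 han

theorem resolventSeq_antitone {a : ℕ → ℝ} (hpos : ∀ n, 0 < a n)
    (hlc : ∀ n, a (n + 1) ^ 2 ≤ a n * a (n + 2)) : Antitone (resolventSeq a) := by
  refine antitone_nat_of_succ_le fun n => ?_
  rw [resolventSeq, Finset.sum_range_succ]
  have := recipSeq_succ_nonpos hpos hlc n
  unfold resolventSeq
  linarith

theorem resolventSeq_nonneg {a : ℕ → ℝ} (hpos : ∀ n, 0 < a n)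
    (hlc : ∀ n, a (n + 1) ^ 2 ≤ a n * a (n + 2)) (hanti : Antitone a) (n : ℕ) :
    0 ≤ resolventSeq a n := by
  have h1 := sum_mul_recipSeq (hpos 0).ne' n
  have h2 : (0 : ℝ) ≤ ∑ i ∈ Finset.range (n + 1), a (n - i) * recipSeq a i := by
    rw [h1]; split_ifs <;> norm_num
  refine nonneg_of_mul_nonneg_right (h2.trans ?_) (hpos n)
  rw [resolventSeq, Finset.mul_sum]
  refine Finset.sum_le_sum fun i _ => ?_
  rcases i with _ | i
  · simp
  · exact mul_le_mul_of_nonpos_right (hanti (Nat.sub_le _ _)) (recipSeq_succ_nonpos hpos hlc i)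

theorem resolventSeq_zero {a : ℕ → ℝ} : resolventSeq a 0 = (a 0)⁻¹ := by
  simp [resolventSeq, recipSeq_zero]

theorem sum_abs_recipSeq_le {a : ℕ → ℝ} (hpos : ∀ n, 0 < a n)
    (hlc : ∀ n, a (n + 1) ^ 2 ≤ a n * a (n + 2)) (hanti : Antitone a) (n : ℕ) :
    ∑ i ∈ Finset.range (n + 1), |recipSeq a i| ≤ 2 * (a 0)⁻¹ := by
  have h1 := resolventSeq_nonneg hpos hlc hanti n
  rw [resolventSeq, Finset.sum_range_succ', recipSeq_zero] at h1
  rw [Finset.sum_range_succ', recipSeq_zero, abs_of_pos (inv_pos.2 (hpos 0)),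
    Finset.sum_congr rfl fun i _ => abs_of_nonpos (recipSeq_succ_nonpos hpos hlc i),
    Finset.sum_neg_distrib]
  linarith

theorem mul_sum_resolventSeq_le {a : ℕ → ℝ} (hpos : ∀ n, 0 < a n)
    (hlc : ∀ n, a (n + 1) ^ 2 ≤ a n * a (n + 2)) (hanti : Antitone a) {m : ℝ} {n : ℕ}
    (hm : m ≤ a n) : m * ∑ i ∈ Finset.range (n + 1), resolventSeq a i ≤ 1 := by
  rw [← sum_mul_resolventSeq (hpos 0).ne' n, Finset.mul_sum]
  refine Finset.sum_le_sum fun i _ => ?_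
  exact mul_le_mul_of_nonneg_right (hm.trans (hanti (Nat.sub_le _ _)))
    (resolventSeq_nonneg hpos hlc hanti i)

theorem mul_resolventSeq_le {a : ℕ → ℝ} (hpos : ∀ n, 0 < a n)
    (hlc : ∀ n, a (n + 1) ^ 2 ≤ a n * a (n + 2)) (hanti : Antitone a) {m : ℝ} {n : ℕ}
    (hm0 : 0 ≤ m) (hm : m ≤ a n) : m * ((n + 1) * resolventSeq a n) ≤ 1 := by
  refine le_trans ?_ (mul_sum_resolventSeq_le hpos hlc hanti hm)
  gcongr
  have := Finset.card_nsmul_le_sum (Finset.range (n + 1)) (resolventSeq a) (resolventSeq a n)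
    fun i hi => resolventSeq_antitone hpos hlc (Nat.lt_succ_iff.1 (Finset.mem_range.1 hi))
  simpa using this

/-! ### The kernel of fractional integration and the weights -/

/-- The kernel `x^(-α) / Γ(1 - α)` of the fractional integral of order `1 - α`. -/
def fracKernel (α x : ℝ) : ℝ :=
  x ^ (-α) / Real.Gamma (1 - α)

section

variable {α : ℝ}

theorem gamma_pos (hα1 : α < 1) : 0 < Real.Gamma (1 - α) :=
  Real.Gamma_pos_of_pos (by linarith)

theorem gamma_two_sub (hα1 : α < 1) :
    Real.Gamma (2 - α) = (1 - α) * Real.Gamma (1 - α) := by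
  rw [← Real.Gamma_add_one (by linarith)]; ring_nf

theorem fracKernel_pos (hα1 : α < 1) {x : ℝ} (hx : 0 < x) : 0 < fracKernel α x :=
  div_pos (Real.rpow_pos_of_pos hx _) (gamma_pos hα1)

theorem fracKernel_nonneg (hα1 : α < 1) {x : ℝ} (hx : 0 ≤ x) : 0 ≤ fracKernel α x :=
  div_nonneg (Real.rpow_nonneg hx _) (gamma_pos hα1).le

theorem fracKernel_anti (hα0 : 0 < α) (hα1 : α < 1) {x y : ℝ} (hx : 0 < x) (hxy : x ≤ y) :
    fracKernel α y ≤ fracKernel α x := by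
  unfold fracKernel
  have := gamma_pos hα1
  gcongr ?_ / _
  exact Real.rpow_le_rpow_of_nonpos hx hxy (by linarith)

theorem intervalIntegrable_fracKernel (hα1 : α < 1) (a b : ℝ) :
    IntervalIntegrable (fracKernel α) volume a b :=
  (intervalIntegral.intervalIntegrable_rpow' (by linarith)).div_const _

theorem intervalIntegrable_fracKernel_add (hα1 : α < 1) (c a b : ℝ) :
    IntervalIntegrable (fun x => fracKernel α (c + x)) volume a b := by
  simpa using (intervalIntegrable_fracKernel hα1 (c + a) (c + b)).comp_add_left c

theorem intervalIntegrable_fracKernel_sub (hα1 : α < 1) (c a b : ℝ) :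
    IntervalIntegrable (fun x => fracKernel α (c - x)) volume a b := by
  simpa using (intervalIntegrable_fracKernel hα1 (c - a) (c - b)).comp_sub_left c

theorem integral_fracKernel (hα1 : α < 1) (a b : ℝ) :
    ∫ x in a..b, fracKernel α x = (b ^ (1 - α) - a ^ (1 - α)) / Real.Gamma (2 - α) := by
  unfold fracKernel
  rw [intervalIntegral.integral_div, integral_rpow (Or.inl (by linarith)), gamma_two_sub hα1,
    div_div, neg_add_eq_sub]

theorem weight_eq_integral (hα1 : α < 1) (j : ℕ) :
    weight α j = ∫ x in (0 : ℝ)..1, fracKernel α (j + x) := by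
  rw [intervalIntegral.integral_comp_add_left (fracKernel α), integral_fracKernel hα1, weight,
    add_zero]

theorem weight_le (hα0 : 0 < α) (hα1 : α < 1) {j : ℕ} (hj : 1 ≤ j) :
    weight α j ≤ fracKernel α j := by
  rw [weight_eq_integral hα1]
  have hj : (1 : ℝ) ≤ j := by exact_mod_cast hj
  have := intervalIntegral.integral_mono_on zero_le_one
    (intervalIntegrable_fracKernel_add hα1 j 0 1) (intervalIntegrable_const (c := fracKernel α j))
    fun x hx => fracKernel_anti hα0 hα1 (by linarith) (by linarith [hx.1])
  simpa using this

theorem le_weight (hα0 : 0 < α) (hα1 : α < 1) (j : ℕ) :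
    fracKernel α (j + 1) ≤ weight α j := by
  rw [weight_eq_integral hα1]
  have := intervalIntegral.integral_mono_on_of_le_Ioo zero_le_one
    (intervalIntegrable_const (c := fracKernel α (j + 1)))
    (intervalIntegrable_fracKernel_add hα1 j 0 1)
    fun x hx => fracKernel_anti hα0 hα1 (by have := hx.1; positivity) (by linarith [hx.2])
  simpa using this

theorem weight_pos (hα0 : 0 < α) (hα1 : α < 1) (j : ℕ) : 0 < weight α j :=
  (fracKernel_pos hα1 (by positivity)).trans_le (le_weight hα0 hα1 j)

theorem weight_antitone (hα0 : 0 < α) (hα1 : α < 1) : Antitone (weight α) := by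
  refine antitone_nat_of_succ_le fun j => ?_
  refine (weight_le hα0 hα1 (Nat.le_add_left 1 j)).trans ?_
  simpa using le_weight hα0 hα1 j

theorem tendsto_weight (hα0 : 0 < α) (hα1 : α < 1) :
    Filter.Tendsto (weight α) Filter.atTop (nhds 0) := by
  have h : Filter.Tendsto (fun j : ℕ => fracKernel α (j : ℝ)) Filter.atTop (nhds 0) := by
    have := ((tendsto_rpow_neg_atTop hα0).comp tendsto_natCast_atTop_atTop).div_const
      (Real.Gamma (1 - α))
    simpa [fracKernel, Function.comp_def] using this
  refine tendsto_of_tendsto_of_tendsto_of_le_of_le' tendsto_const_nhds h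
    (Filter.Eventually.of_forall fun j => (weight_pos hα0 hα1 j).le) ?_
  filter_upwards [Filter.eventually_ge_atTop 1] with j hj using weight_le hα0 hα1 hj

theorem mul_fracKernel_sub_le (hα0 : 0 < α) (hα1 : α < 1) {x : ℝ} (hx : 1 ≤ x) :
    x * (fracKernel α x - fracKernel α (x + 1)) ≤ (Real.Gamma (1 - α))⁻¹ := by
  have hx0 : 0 < x := by linarith
  have h1 : (1 + x⁻¹) ^ α ≤ 1 + α * x⁻¹ :=
    rpow_one_add_le_one_add_mul_self (by linarith [inv_pos.2 hx0]) hα0.le hα1.le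
  have h2 : x ^ (-α) = (x + 1) ^ (-α) * (1 + x⁻¹) ^ α := by
    rw [show 1 + x⁻¹ = (x + 1) / x by field_simp, Real.div_rpow (by linarith) hx0.le,
      Real.rpow_neg hx0.le, Real.rpow_neg (by linarith)]
    have := (Real.rpow_pos_of_pos (show 0 < x + 1 by linarith) α).ne'
    field_simp
  have h3 : (x + 1) ^ (-α) ≤ 1 :=
    Real.rpow_le_one_of_one_le_of_nonpos (by linarith) (by linarith)
  have h4 : 0 < (x + 1) ^ (-α) := Real.rpow_pos_of_pos (by linarith) _
  unfold fracKernel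
  have := gamma_pos hα1
  rw [← sub_div, mul_div_assoc', inv_eq_one_div]
  gcongr ?_ / _
  calc x * (x ^ (-α) - (x + 1) ^ (-α))
      = (x + 1) ^ (-α) * (x * ((1 + x⁻¹) ^ α - 1)) := by rw [h2]; ring
    _ ≤ (x + 1) ^ (-α) * (x * (α * x⁻¹)) := by gcongr; linarith
    _ = (x + 1) ^ (-α) * α := by rw [mul_left_comm x, mul_inv_cancel₀ hx0.ne', mul_one]
    _ ≤ 1 := by nlinarith

/-- The kernel is log-convex. -/
theorem fracKernel_sq_le (hα0 : 0 < α) (hα1 : α < 1) {x : ℝ} (hx : 0 < x) :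
    fracKernel α (x + 1) ^ 2 ≤ fracKernel α x * fracKernel α (x + 2) := by
  unfold fracKernel
  rw [div_pow, div_mul_div_comm, ← pow_two (Real.Gamma _)]
  gcongr ?_ / _
  rw [pow_two, ← Real.mul_rpow (by linarith) (by linarith),
    ← Real.mul_rpow (by linarith) (by linarith)]
  exact Real.rpow_le_rpow_of_nonpos (by positivity) (by nlinarith) (by linarith)

/-- Log-convexity of the weights, in the form of a quadratic inequality: the discriminant in `θ`
is nonpositive. This form is stable under integration and under adding a constant. -/
theorem weight_quadratic_nonneg (hα0 : 0 < α) (hα1 : α < 1) (j : ℕ) (θ : ℝ) :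
    0 ≤ θ ^ 2 * weight α j - 2 * θ * weight α (j + 1) + weight α (j + 2) := by
  have hi := fun c : ℝ => intervalIntegrable_fracKernel_add hα1 c 0 1
  rw [weight_eq_integral hα1, weight_eq_integral hα1, weight_eq_integral hα1,
    ← intervalIntegral.integral_const_mul, ← intervalIntegral.integral_const_mul,
    ← intervalIntegral.integral_sub ((hi _).const_mul _) ((hi _).const_mul _),
    ← intervalIntegral.integral_add (((hi _).const_mul _).sub ((hi _).const_mul _)) (hi _)]
  refine intervalIntegral.integral_nonneg_of_ae_restrict zero_le_one ?_
  rw [Filter.EventuallyLE, ae_restrict_iff' measurableSet_Icc]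
  filter_upwards [Measure.ae_ne volume (0 : ℝ)] with x hx0 hx
  have hx : 0 < j + x := by
    have : 0 < x := lt_of_le_of_ne hx.1 hx0.symm
    positivity
  have h1 := fracKernel_sq_le hα0 hα1 hx
  have h2 := fracKernel_pos hα1 hx
  simp only [Pi.zero_apply]
  push_cast
  rw [show (j : ℝ) + 1 + x = j + x + 1 by ring, show (j : ℝ) + 2 + x = j + x + 2 by ring]
  refine nonneg_of_mul_nonneg_right (a := fracKernel α (j + x)) ?_ h2
  nlinarith [sq_nonneg (θ * fracKernel α (j + x) - fracKernel α (j + x + 1))]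

/-- The coefficients of the implicit scheme `∑ᵢ (b_{n-i} + μ) Uⁱ = …` obtained by summing the L1
scheme over the time levels. -/
def summedWeight (α μ : ℝ) (j : ℕ) : ℝ :=
  weight α j + μ

variable {μ : ℝ}

theorem summedWeight_pos (hα0 : 0 < α) (hα1 : α < 1) (hμ : 0 ≤ μ) (j : ℕ) :
    0 < summedWeight α μ j :=
  add_pos_of_pos_of_nonneg (weight_pos hα0 hα1 j) hμ

theorem summedWeight_antitone (hα0 : 0 < α) (hα1 : α < 1) : Antitone (summedWeight α μ) :=
  fun _ _ h => by simpa [summedWeight] using weight_antitone hα0 hα1 h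

theorem summedWeight_logConvex (hα0 : 0 < α) (hα1 : α < 1) (hμ : 0 ≤ μ) (j : ℕ) :
    summedWeight α μ (j + 1) ^ 2 ≤ summedWeight α μ j * summedWeight α μ (j + 2) := by
  have h0 := summedWeight_pos hα0 hα1 hμ j
  set θ := summedWeight α μ (j + 1) / summedWeight α μ j with hθ
  have h1 : θ * summedWeight α μ j = summedWeight α μ (j + 1) := div_mul_cancel₀ _ h0.ne'
  have h2 : 0 ≤ θ ^ 2 * summedWeight α μ j - 2 * θ * summedWeight α μ (j + 1)
      + summedWeight α μ (j + 2) := by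
    have := weight_quadratic_nonneg hα0 hα1 j θ
    have := mul_nonneg hμ (sq_nonneg (θ - 1))
    unfold summedWeight
    linarith
  have h3 := mul_nonneg h0.le h2
  rw [← h1] at h3 ⊢
  nlinarith

end

/-! ### The discrete solution -/

section

theorem eq_sum_recipSeq {a : ℕ → ℝ} (ha : a 0 ≠ 0) (x : ℕ → ℝ) (n : ℕ) :
    x n = ∑ M ∈ Finset.range (n + 1), recipSeq a (n - M) *
      ∑ i ∈ Finset.range (M + 1), a (M - i) * x i := by
  have h1 : PowerSeries.mk x * PowerSeries.mk a
      = PowerSeries.mk fun M => ∑ i ∈ Finset.range (M + 1), a (M - i) * x i := by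
    ext M
    rw [PowerSeries.coeff_mul, Finset.Nat.sum_antidiagonal_eq_sum_range_succ_mk]
    simp [mul_comm]
  have h2 : PowerSeries.mk x = (PowerSeries.mk fun M =>
      ∑ i ∈ Finset.range (M + 1), a (M - i) * x i) * PowerSeries.mk (recipSeq a) := by
    rw [← h1, mul_assoc, mk_mul_recipSeq ha, mul_one]
  have h3 := congrArg (PowerSeries.coeff n) h2
  rw [PowerSeries.coeff_mul, Finset.Nat.sum_antidiagonal_eq_sum_range_succ_mk] at h3
  simpa [mul_comm] using h3

/-- The solution of the scalar L1 scheme with unit initial value, `μ = λ τ^α`. -/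
def discreteSol (α μ : ℝ) (n : ℕ) : ℝ :=
  1 - μ * ∑ j ∈ Finset.range n, resolventSeq (summedWeight α μ) j

/-- The L1 scheme summed over the time levels up to `M + 1`. -/
def IsSummedSol (α μ : ℝ) (N : ℕ) (U : ℕ → ℝ) : Prop :=
  ∀ M < N, ∑ i ∈ Finset.range (M + 1), summedWeight α μ (M - i) * U (i + 1) =
    U 0 * ∑ i ∈ Finset.range (M + 1), weight α i

variable {α μ : ℝ} {N : ℕ}

theorem isSummedSol_of_step {U : ℕ → ℝ}
    (h : ∀ n : ℕ, 1 ≤ n → n ≤ N → weight α 0 * U n + μ * U n = weight α (n - 1) * U 0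
      + ∑ j ∈ Finset.Icc 1 (n - 1), (weight α (j - 1) - weight α j) * U (n - j)) :
    IsSummedSol α μ N U := by
  intro M
  induction M with
  | zero =>
    intro hM
    have := h 1 le_rfl hM
    simp only [Nat.sub_self, Finset.Icc_eq_empty_of_lt one_pos, Finset.sum_empty,
      add_zero] at this
    simp only [zero_add, Finset.range_one, Finset.sum_singleton, Nat.sub_self, summedWeight]
    linarith
  | succ M ih =>
    intro hM
    have h1 := ih (by omega)
    have h2 := h (M + 2) (by omega) (by omega)
    have h3 : ∑ j ∈ Finset.Icc 1 (M + 2 - 1), (weight α (j - 1) - weight α j) * U (M + 2 - j)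
        = ∑ i ∈ Finset.range (M + 1), (weight α (M - i) - weight α (M + 1 - i)) * U (i + 1) := by
      refine Finset.sum_nbij' (fun j => M + 1 - j) (fun i => M + 1 - i) ?_ ?_ ?_ ?_ ?_
      · intro j hj; simp only [Finset.mem_Icc, Finset.mem_range] at *; omega
      · intro j hj; simp only [Finset.mem_Icc, Finset.mem_range] at *; omega
      · intro j hj; simp only [Finset.mem_Icc] at *; omega
      · intro j hj; simp only [Finset.mem_range] at *; omega
      · intro j hj
        simp only [Finset.mem_Icc] at hj
        rw [show M - (M + 1 - j) = j - 1 by omega, show M + 1 - (M + 1 - j) = j by omega,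
          show M + 1 - j + 1 = M + 2 - j by omega]
    rw [h3] at h2
    rw [Finset.sum_range_succ, Finset.sum_range_succ (weight α), mul_add, ← h1, Nat.sub_self]
    simp only [sub_mul, Finset.sum_sub_distrib, summedWeight, add_mul,
      Finset.sum_add_distrib] at h2 ⊢
    rw [show M + 2 - 1 = M + 1 by omega] at h2
    linarith

theorem isSummedSol_mul_discreteSol (hα0 : 0 < α) (hα1 : α < 1) (hμ : 0 ≤ μ) (c : ℝ) :
    IsSummedSol α μ N fun n => c * discreteSol α μ n := by
  intro M _
  have ha := (summedWeight_pos hα0 hα1 hμ 0).ne'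
  set a := summedWeight α μ with ha'
  have h1 : PowerSeries.mk (fun i => discreteSol α μ (i + 1)) =
      PowerSeries.mk 1 - PowerSeries.C μ * (PowerSeries.mk (resolventSeq a) *
        PowerSeries.mk 1) := by
    ext n
    rw [map_sub, PowerSeries.coeff_C_mul, PowerSeries.coeff_mul,
      Finset.Nat.sum_antidiagonal_eq_sum_range_succ_mk]
    simp [discreteSol, ha']
  have h2 : PowerSeries.mk (fun i => discreteSol α μ (i + 1)) * PowerSeries.mk a =
      PowerSeries.mk 1 * PowerSeries.mk a - PowerSeries.C μ * (PowerSeries.mk 1 *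
        PowerSeries.mk 1) := by
    have h := mk_mul_recipSeq ha
    rw [h1, mk_resolventSeq]
    linear_combination (-PowerSeries.C μ * (PowerSeries.mk 1 * PowerSeries.mk 1)) * h
  have h3 := congrArg (PowerSeries.coeff M) h2
  rw [map_sub, mul_comm (PowerSeries.mk 1) (PowerSeries.mk a), PowerSeries.coeff_C_mul,
    PowerSeries.coeff_mul, PowerSeries.coeff_mul, PowerSeries.coeff_mul,
    Finset.Nat.sum_antidiagonal_eq_sum_range_succ_mk,
    Finset.Nat.sum_antidiagonal_eq_sum_range_succ_mk,
    Finset.Nat.sum_antidiagonal_eq_sum_range_succ_mk] at h3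
  simp only [PowerSeries.coeff_mk, Pi.one_apply, mul_one, Finset.sum_const, Finset.card_range,
    nsmul_eq_mul] at h3
  have h4 : ∑ i ∈ Finset.range (M + 1), a i = ∑ i ∈ Finset.range (M + 1), weight α i
      + (M + 1 : ℕ) * μ := by
    simp [ha', summedWeight, Finset.sum_add_distrib]
  have h5 : discreteSol α μ 0 = 1 := by simp [discreteSol]
  beta_reduce
  rw [h5, mul_one, show ∑ i ∈ Finset.range (M + 1), weight α i = ∑ i ∈ Finset.range (M + 1),
    discreteSol α μ (i + 1) * a (M - i) by rw [h3, h4]; ring, Finset.mul_sum]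
  exact Finset.sum_congr rfl fun i _ => by ring

theorem IsSummedSol.eq {U U' : ℕ → ℝ} (hα0 : 0 < α) (hα1 : α < 1) (hμ : 0 ≤ μ)
    (hU : IsSummedSol α μ N U) (hU' : IsSummedSol α μ N U') (h0 : U 0 = U' 0) {n : ℕ}
    (hn : n ≤ N) : U n = U' n := by
  rcases n with _ | n
  · exact h0
  have ha := (summedWeight_pos hα0 hα1 hμ 0).ne'
  rw [eq_sum_recipSeq ha (fun i => U (i + 1)) n, eq_sum_recipSeq ha (fun i => U' (i + 1)) n]
  refine Finset.sum_congr rfl fun M hM => ?_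
  have hM := Finset.mem_range.1 hM
  rw [hU M (by omega), hU' M (by omega), h0]

theorem IsSummedSol.eq_mul_discreteSol {U : ℕ → ℝ} (hα0 : 0 < α) (hα1 : α < 1) (hμ : 0 ≤ μ)
    (hU : IsSummedSol α μ N U) {n : ℕ} (hn : n ≤ N) : U n = U 0 * discreteSol α μ n :=
  hU.eq hα0 hα1 hμ (isSummedSol_mul_discreteSol hα0 hα1 hμ (U 0)) (by simp [discreteSol]) hn

theorem discreteSol_antitone (hα0 : 0 < α) (hα1 : α < 1) (hμ : 0 ≤ μ) :
    Antitone (discreteSol α μ) := by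
  refine antitone_nat_of_succ_le fun n => ?_
  have := mul_nonneg hμ (resolventSeq_nonneg (summedWeight_pos hα0 hα1 hμ)
    (summedWeight_logConvex hα0 hα1 hμ) (summedWeight_antitone hα0 hα1) n)
  rw [discreteSol, discreteSol, Finset.sum_range_succ]
  linarith

theorem discreteSol_nonneg (hα0 : 0 < α) (hα1 : α < 1) (hμ : 0 ≤ μ) (n : ℕ) :
    0 ≤ discreteSol α μ n := by
  refine le_trans ?_ (discreteSol_antitone hα0 hα1 hμ (Nat.le_succ n))
  have := mul_sum_resolventSeq_le (summedWeight_pos hα0 hα1 hμ)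
    (summedWeight_logConvex hα0 hα1 hμ) (summedWeight_antitone hα0 hα1)
    (m := μ) (n := n) (by simpa [summedWeight] using (weight_pos hα0 hα1 n).le)
  rw [discreteSol]
  linarith

theorem discreteSol_le_one (hα0 : 0 < α) (hα1 : α < 1) (hμ : 0 ≤ μ) (n : ℕ) :
    discreteSol α μ n ≤ 1 := by
  have := discreteSol_antitone hα0 hα1 hμ (Nat.zero_le n)
  simpa [discreteSol] using this

/-- The discrete solution is convex: its differences over intervals of fixed length decrease. -/
theorem discreteSol_sub_antitone (hα0 : 0 < α) (hα1 : α < 1) (hμ : 0 ≤ μ)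
    {p q : ℕ} (h : p ≤ q) (m : ℕ) :
    discreteSol α μ (p + m) - discreteSol α μ (q + m) ≤ discreteSol α μ p - discreteSol α μ q := by
  have key : ∀ p q : ℕ, p ≤ q → discreteSol α μ p - discreteSol α μ q =
      μ * ∑ j ∈ Finset.range (q - p), resolventSeq (summedWeight α μ) (p + j) := by
    intro p q h
    have := Finset.sum_range_add (resolventSeq (summedWeight α μ)) p (q - p)
    rw [show p + (q - p) = q by omega] at this
    rw [discreteSol, discreteSol, this]
    ring
  rw [key _ _ h, key _ _ (Nat.add_le_add_right h m), show q + m - (p + m) = q - p by omega]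
  gcongr with j _
  exact resolventSeq_antitone (summedWeight_pos hα0 hα1 hμ)
    (summedWeight_logConvex hα0 hα1 hμ) (by omega)

theorem one_sub_discreteSol_le (hα0 : 0 < α) (hα1 : α < 1) (hμ : 0 ≤ μ)
    {n : ℕ} (hn : 1 ≤ n) :
    1 - discreteSol α μ n ≤ μ * (Real.Gamma (1 - α) * (n : ℝ) ^ α) := by
  obtain ⟨n, rfl⟩ : ∃ k, n = k + 1 := ⟨n - 1, by omega⟩
  have h1 := mul_sum_resolventSeq_le (summedWeight_pos hα0 hα1 hμ)
    (summedWeight_logConvex hα0 hα1 hμ) (summedWeight_antitone hα0 hα1)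
    (m := fracKernel α (n + 1)) (n := n)
    ((le_weight hα0 hα1 n).trans (by simpa [summedWeight] using hμ))
  rw [discreteSol, sub_sub_cancel]
  gcongr
  have hx : (0 : ℝ) < n + 1 := by positivity
  rw [← le_div_iff₀' (fracKernel_pos hα1 hx)] at h1
  refine h1.trans (le_of_eq ?_)
  rw [fracKernel, Real.rpow_neg hx.le]
  push_cast
  field_simp

end

/-! ### The time-integrated continuous problem -/

section

/-- The scalar equation `∂ₜ^α w + μ w = 0` on `[0, T]`, integrated once in time. -/
structure IsIntegratedSol (α μ T : ℝ) (w : ℝ → ℝ) : Prop where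
  continuousOn : ContinuousOn w (Icc 0 T)
  equation : ∀ t ∈ Icc 0 T,
    (∫ s in (0 : ℝ)..t, fracKernel α (t - s) * (w s - w 0)) + μ * ∫ s in (0 : ℝ)..t, w s = 0

variable {α μ : ℝ} {N : ℕ} {w : ℝ → ℝ}

theorem IsIntegratedSol.neg {T : ℝ} (h : IsIntegratedSol α μ T w) :
    IsIntegratedSol α μ T fun s => -w s := by
  refine ⟨h.continuousOn.neg, fun t ht => ?_⟩
  have := h.equation t ht
  rw [intervalIntegral.integral_neg, intervalIntegral.integral_congr
    (g := fun s => -(fracKernel α (t - s) * (w s - w 0))) fun s _ => by ring,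
    intervalIntegral.integral_neg]
  linarith

theorem IsIntegratedSol.comp_mul {T S τ : ℝ} (h : IsIntegratedSol α μ T w) (hτ : 0 < τ)
    (hS : S * τ = T) : IsIntegratedSol α (μ * τ ^ α) S fun s => w (τ * s) := by
  have hmem : ∀ s ∈ Icc 0 S, τ * s ∈ Icc 0 T := fun s hs =>
    ⟨mul_nonneg hτ.le hs.1, by rw [← hS, mul_comm]; exact mul_le_mul_of_nonneg_right hs.2 hτ.le⟩
  refine ⟨h.continuousOn.comp (by fun_prop) hmem, fun t ht => ?_⟩
  have h1 := h.equation _ (hmem t ht)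
  have e1 : ∫ s in (0 : ℝ)..τ * t, w s = τ * ∫ s in (0 : ℝ)..t, w (τ * s) := by
    rw [intervalIntegral.integral_comp_mul_left (fun s => w s) hτ.ne', mul_zero, smul_eq_mul,
      mul_inv_cancel_left₀ hτ.ne']
  have e2 : ∫ s in (0 : ℝ)..τ * t, fracKernel α (τ * t - s) * (w s - w 0) =
      τ * (τ ^ (-α) * ∫ s in (0 : ℝ)..t, fracKernel α (t - s) * (w (τ * s) - w (τ * 0))) := by
    have := intervalIntegral.integral_comp_mul_left (a := 0) (b := t)
      (fun s => fracKernel α (τ * t - s) * (w s - w 0)) hτ.ne'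
    rw [mul_zero, smul_eq_mul, eq_inv_mul_iff_mul_eq₀ hτ.ne'] at this
    rw [← this, ← intervalIntegral.integral_const_mul (τ ^ (-α)), mul_zero]
    refine congrArg (τ * ·) (intervalIntegral.integral_congr fun s hs => ?_)
    rw [uIcc_of_le ht.1] at hs
    have : 0 ≤ t - s := by linarith [hs.2]
    simp only [fracKernel]
    rw [← mul_sub, Real.mul_rpow hτ.le this]
    ring
  rw [e1, e2] at h1
  have h2 : τ ^ (-α) * τ ^ α = 1 := by
    rw [← Real.rpow_add hτ, neg_add_cancel, Real.rpow_zero]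
  have h3 : 0 < τ * τ ^ (-α) := mul_pos hτ (Real.rpow_pos_of_pos hτ _)
  refine (mul_eq_zero.1 ?_).resolve_left h3.ne'
  linear_combination h1 + (τ * (μ * ∫ s in (0 : ℝ)..t, w (τ * s))) * h2

theorem reflected_mem {i : ℕ} (hi : i < N) {x : ℝ} (hx : x ∈ Icc (0 : ℝ) 1) :
    (i : ℝ) + 1 - x ∈ Icc (0 : ℝ) N := by
  have h1 : (i : ℝ) + 1 ≤ N := by exact_mod_cast hi
  have h2 : (0 : ℝ) ≤ i := i.cast_nonneg
  exact ⟨by linarith [hx.2], by linarith [hx.1]⟩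

theorem continuousOn_reflected (hw : ContinuousOn w (Icc 0 (N : ℝ))) {i : ℕ} (hi : i < N) :
    ContinuousOn (fun x : ℝ => w (i + 1 - x)) (uIcc 0 1) := by
  rw [uIcc_of_le zero_le_one]
  exact hw.comp (by fun_prop) fun x hx => reflected_mem hi hx

/-- The integrated equation at an integer time, folded onto the unit interval. -/
theorem IsIntegratedSol.folded (hα1 : α < 1) (h : IsIntegratedSol α μ N w) {M : ℕ} (hM : M < N) :
    ∑ i ∈ Finset.range (M + 1), ∫ x in (0 : ℝ)..1,
      (fracKernel α ((M - i : ℕ) + x) + μ) * w (i + 1 - x) =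
    w 0 * ∑ i ∈ Finset.range (M + 1), weight α i := by
  have hMN : (M : ℝ) + 1 ≤ N := by exact_mod_cast hM
  have hM0 : (0 : ℝ) ≤ M := M.cast_nonneg
  have hcont : ContinuousOn w (uIcc 0 ((M : ℝ) + 1)) := by
    rw [uIcc_of_le (by linarith)]
    exact h.continuousOn.mono (Icc_subset_Icc le_rfl hMN)
  have hint₀ : IntervalIntegrable (fun s => fracKernel α (M + 1 - s) * (w s - w 0))
      volume 0 ((M : ℝ) + 1) :=
    (intervalIntegrable_fracKernel_sub hα1 _ _ _).mul_continuousOn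
      (hcont.sub continuousOn_const)
  have hint₁ : IntervalIntegrable (fun s => μ * w s) volume 0 ((M : ℝ) + 1) :=
    hcont.intervalIntegrable.const_mul _
  have hint := hint₀.add hint₁
  have h1 : ∫ s in (0 : ℝ)..(M + 1), (fracKernel α (M + 1 - s) * (w s - w 0) + μ * w s) = 0 := by
    rw [intervalIntegral.integral_add hint₀ hint₁, intervalIntegral.integral_const_mul]
    exact h.equation _ ⟨by linarith, hMN⟩
  have h2 := intervalIntegral.sum_integral_adjacent_intervals (a := fun k : ℕ => (k : ℝ))
    (n := M + 1) (μ := volume)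
    (f := fun s => fracKernel α (M + 1 - s) * (w s - w 0) + μ * w s) fun k hk => by
      refine hint.mono_set ?_
      have hk1 : (k : ℝ) + 1 ≤ M + 1 := by exact_mod_cast hk
      have hk0 : (0 : ℝ) ≤ k := k.cast_nonneg
      push_cast
      rw [uIcc_of_le (by linarith), uIcc_of_le (by linarith)]
      exact Icc_subset_Icc hk0 hk1
  push_cast at h2
  rw [h1] at h2
  have h3 : ∀ i ∈ Finset.range (M + 1),
      ∫ s in (i : ℝ)..(i + 1), (fracKernel α (M + 1 - s) * (w s - w 0) + μ * w s) =
      (∫ x in (0 : ℝ)..1, (fracKernel α ((M - i : ℕ) + x) + μ) * w (i + 1 - x))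
        - w 0 * weight α (M - i) := by
    intro i hi
    have hi := Finset.mem_range.1 hi
    have hiM : ((M - i : ℕ) : ℝ) = M - i := Nat.cast_sub (by omega)
    have hk := intervalIntegrable_fracKernel_add hα1 ((M - i : ℕ) : ℝ) 0 1
    have := intervalIntegral.integral_comp_sub_left (a := 0) (b := 1)
      (fun s => fracKernel α (M + 1 - s) * (w s - w 0) + μ * w s) ((i : ℝ) + 1)
    rw [add_sub_cancel_right, sub_zero] at this
    rw [← this, weight_eq_integral hα1, ← intervalIntegral.integral_const_mul,
      ← intervalIntegral.integral_sub _ (hk.const_mul _)]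
    · refine intervalIntegral.integral_congr fun x _ => ?_
      rw [hiM, show (M : ℝ) + 1 - (i + 1 - x) = M - i + x by ring]
      ring
    · exact (hk.add intervalIntegrable_const).mul_continuousOn
        (continuousOn_reflected h.continuousOn (by omega))
  rw [Finset.sum_congr rfl h3, Finset.sum_sub_distrib, sub_eq_zero] at h2
  rw [h2, ← Finset.mul_sum]
  congr 1
  exact Finset.sum_range_reflect (weight α) (M + 1)

/-- The consistency error of the L1 scheme, summed over the time levels up to `M + 1`. -/
def summedDefect (α μ : ℝ) (w : ℝ → ℝ) (M : ℕ) : ℝ :=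
  ∑ i ∈ Finset.range (M + 1), ∫ x in (0 : ℝ)..1,
    (fracKernel α ((M - i : ℕ) + x) + μ) * (w (i + 1 - x) - w (i + 1))

theorem sum_summedWeight_mul_error (hα1 : α < 1) (h : IsIntegratedSol α μ N w) {U : ℕ → ℝ}
    (hU : IsSummedSol α μ N U) (h0 : U 0 = w 0) {M : ℕ} (hM : M < N) :
    ∑ i ∈ Finset.range (M + 1), summedWeight α μ (M - i) * (w (i + 1) - U (i + 1)) =
      -summedDefect α μ w M := by
  have h1 := h.folded hα1 hM
  rw [← h0, ← hU M hM, ← sub_eq_zero, ← Finset.sum_sub_distrib] at h1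
  rw [eq_neg_iff_add_eq_zero, summedDefect, ← Finset.sum_add_distrib]
  refine Eq.trans ?_ h1
  refine Finset.sum_congr rfl fun i hi => ?_
  have hi := Finset.mem_range.1 hi
  have hk := (intervalIntegrable_fracKernel_add hα1 ((M - i : ℕ) : ℝ) 0 1).add
    (intervalIntegrable_const (c := μ))
  have e : summedWeight α μ (M - i) * w (i + 1) = ∫ x in (0 : ℝ)..1,
      (fracKernel α ((M - i : ℕ) + x) + μ) * w (i + 1) := by
    rw [intervalIntegral.integral_mul_const, intervalIntegral.integral_add
      (intervalIntegrable_fracKernel_add hα1 _ _ _) intervalIntegrable_const,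
      ← weight_eq_integral hα1]
    simp [summedWeight]
  have hd : IntervalIntegrable (fun x => (fracKernel α ((M - i : ℕ) + x) + μ) *
      (w (i + 1 - x) - w (i + 1))) volume 0 1 := hk.mul_continuousOn
    ((continuousOn_reflected h.continuousOn (by omega)).sub continuousOn_const)
  rw [mul_sub, e, sub_add_eq_add_sub]
  congr 1
  rw [← intervalIntegral.integral_add (hk.mul_const _) hd]
  exact intervalIntegral.integral_congr (μ := volume) fun x _ => by ring

theorem error_eq (hα0 : 0 < α) (hα1 : α < 1) (hμ : 0 ≤ μ) (h : IsIntegratedSol α μ N w)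
    {U : ℕ → ℝ} (hU : IsSummedSol α μ N U) (h0 : U 0 = w 0) {n : ℕ} (hn : n < N) :
    w (n + 1) - U (n + 1) = -∑ M ∈ Finset.range (n + 1),
      recipSeq (summedWeight α μ) (n - M) * summedDefect α μ w M := by
  rw [eq_sum_recipSeq (summedWeight_pos hα0 hα1 hμ 0).ne' (fun i => w (i + 1) - U (i + 1)) n,
    ← Finset.sum_neg_distrib]
  refine Finset.sum_congr rfl fun M hM => ?_
  have hM := Finset.mem_range.1 hM
  rw [sum_summedWeight_mul_error hα1 h hU h0 (by omega), mul_neg]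

/-! ### Convergence under refinement -/

theorem abs_error_le (hα0 : 0 < α) (hα1 : α < 1) (hμ : 0 ≤ μ) (h : IsIntegratedSol α μ N w)
    {U : ℕ → ℝ} (hU : IsSummedSol α μ N U) (h0 : U 0 = w 0) {B : ℝ}
    (hB : ∀ M < N, |summedDefect α μ w M| ≤ B) {n : ℕ} (hn : n < N) :
    |w (n + 1) - U (n + 1)| ≤ 2 * (weight α 0)⁻¹ * B := by
  have hB0 : 0 ≤ B := (abs_nonneg _).trans (hB n hn)
  have hpos := summedWeight_pos hα0 hα1 hμ
  rw [error_eq hα0 hα1 hμ h hU h0 hn, abs_neg]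
  calc _ ≤ ∑ M ∈ Finset.range (n + 1),
        |recipSeq (summedWeight α μ) (n - M) * summedDefect α μ w M| :=
          Finset.abs_sum_le_sum_abs _ _
    _ ≤ ∑ M ∈ Finset.range (n + 1), |recipSeq (summedWeight α μ) (n - M)| * B := by
        refine Finset.sum_le_sum fun M hM => ?_
        have hM := Finset.mem_range.1 hM
        rw [abs_mul]
        gcongr
        exact hB M (by omega)
    _ = (∑ i ∈ Finset.range (n + 1), |recipSeq (summedWeight α μ) i|) * B := by
        rw [← Finset.sum_mul]
        congr 1
        exact Finset.sum_range_reflect (fun i => |recipSeq (summedWeight α μ) i|) (n + 1)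
    _ ≤ 2 * (weight α 0)⁻¹ * B := by
        gcongr
        refine (sum_abs_recipSeq_le hpos (summedWeight_logConvex hα0 hα1 hμ)
          (summedWeight_antitone hα0 hα1) n).trans ?_
        gcongr
        · exact weight_pos hα0 hα1 0
        · simpa [summedWeight] using hμ

/-- `V` controls the variation of `w` on `[0, T]`. -/
structure IsVariationBound (T : ℝ) (w V : ℝ → ℝ) : Prop where
  continuousOn : ContinuousOn V (Icc 0 T)
  abs_sub_le : ∀ s ∈ Icc 0 T, ∀ t ∈ Icc 0 T, s ≤ t → |w t - w s| ≤ V t - V s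

theorem IsVariationBound.monotoneOn {T : ℝ} {V : ℝ → ℝ} (h : IsVariationBound T w V) :
    MonotoneOn V (Icc 0 T) :=
  fun s hs t ht hst => sub_nonneg.1 ((abs_nonneg _).trans (h.abs_sub_le s hs t ht hst))

theorem IsVariationBound.comp_mul {T S τ : ℝ} {V : ℝ → ℝ} (h : IsVariationBound T w V)
    (hτ : 0 < τ) (hS : S * τ = T) :
    IsVariationBound S (fun s => w (τ * s)) fun s => V (τ * s) := by
  have hmem : ∀ s ∈ Icc 0 S, τ * s ∈ Icc 0 T := fun s hs =>
    ⟨mul_nonneg hτ.le hs.1, by rw [← hS, mul_comm]; exact mul_le_mul_of_nonneg_right hs.2 hτ.le⟩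
  exact ⟨h.continuousOn.comp (by fun_prop) hmem, fun s hs t ht hst =>
    h.abs_sub_le _ (hmem s hs) _ (hmem t ht) (mul_le_mul_of_nonneg_left hst hτ.le)⟩

/-- A bound for the summed defect that tends to zero relative to the weights under refinement of the
step size, for every solution of bounded variation. -/
theorem abs_summedDefect_le (hα0 : 0 < α) (hα1 : α < 1) (hμ : 0 ≤ μ)
    {V : ℝ → ℝ} (hV : IsVariationBound N w V) {J : ℕ} {ε : ℝ}
    (hε : ∀ s ∈ Icc (0 : ℝ) N, ∀ t ∈ Icc (0 : ℝ) N, s ≤ t → t ≤ s + J → V t - V s ≤ ε)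
    {M : ℕ} (hM : M < N) :
    |summedDefect α μ w M| ≤ (μ + weight α J) * (V N - V 0) + weight α 0 * ε := by
  have hcast : ∀ i ≤ N, (i : ℝ) ∈ Icc (0 : ℝ) N := fun i hi =>
    ⟨i.cast_nonneg, by exact_mod_cast hi⟩
  have hmono := hV.monotoneOn
  have hpos := weight_pos hα0 hα1
  have hstep : ∀ i < N, 0 ≤ V (i + 1) - V i := fun i hi => by
    have := hmono (hcast i hi.le) (hcast (i + 1) hi) (by push_cast; linarith)
    push_cast at this
    linarith
  -- The weights with index at least `J` are small, the others only see a short time interval.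
  have key : ∀ i ∈ Finset.range (M + 1), |∫ x in (0 : ℝ)..1,
      (fracKernel α ((M - i : ℕ) + x) + μ) * (w (i + 1 - x) - w (i + 1))| ≤
      (μ + weight α J) * (V (i + 1) - V i)
        + if M + 1 - J ≤ i then weight α 0 * (V (i + 1) - V i) else 0 := by
    intro i hi
    have hi := Finset.mem_range.1 hi
    have hiN : i < N := by omega
    have hk := (intervalIntegrable_fracKernel_add hα1 ((M - i : ℕ) : ℝ) 0 1).add
      (intervalIntegrable_const (c := μ))
    have h1 : |∫ x in (0 : ℝ)..1, (fracKernel α ((M - i : ℕ) + x) + μ)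
        * (w (i + 1 - x) - w (i + 1))| ≤ ∫ x in (0 : ℝ)..1,
        (fracKernel α ((M - i : ℕ) + x) + μ) * (V (i + 1) - V i) := by
      rw [← Real.norm_eq_abs]
      refine intervalIntegral.norm_integral_le_of_norm_le zero_le_one
        (Filter.Eventually.of_forall fun x hx => ?_) (hk.mul_const _)
      have hx' : x ∈ Icc (0 : ℝ) 1 := ⟨hx.1.le, hx.2⟩
      have hkx : 0 ≤ fracKernel α ((M - i : ℕ) + x) + μ :=
        add_nonneg (fracKernel_nonneg hα1 (add_nonneg (Nat.cast_nonneg _) hx.1.le)) hμ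
      have hi1 : (i : ℝ) + 1 ∈ Icc (0 : ℝ) N := by exact_mod_cast hcast (i + 1) hiN
      rw [Real.norm_eq_abs, abs_mul, abs_of_nonneg hkx, abs_sub_comm]
      refine mul_le_mul_of_nonneg_left ?_ hkx
      refine (hV.abs_sub_le _ (reflected_mem hiN hx') _ hi1 (by linarith [hx.1])).trans ?_
      have := hmono (hcast i hiN.le) (reflected_mem hiN hx') (by linarith [hx.2])
      linarith
    rw [intervalIntegral.integral_mul_const, intervalIntegral.integral_add
      (intervalIntegrable_fracKernel_add hα1 _ _ _) intervalIntegrable_const,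
      ← weight_eq_integral hα1] at h1
    simp only [intervalIntegral.integral_const, sub_zero, one_smul] at h1
    refine h1.trans ?_
    have hs := hstep i hiN
    split_ifs with hJ
    · have := mul_le_mul_of_nonneg_right (weight_antitone hα0 hα1 (Nat.zero_le (M - i))) hs
      have := mul_nonneg (hpos J).le hs
      linarith
    · have := mul_le_mul_of_nonneg_right
        (weight_antitone hα0 hα1 (show J ≤ M - i by omega)) hs
      linarith
  refine (Finset.abs_sum_le_sum_abs _ _).trans ((Finset.sum_le_sum key).trans ?_)
  have htel : ∀ p q : ℕ, p ≤ q →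
      ∑ i ∈ Finset.Ico p q, (V (i + 1) - V i) = V q - V p := by
    intro p q hpq
    simpa using Finset.sum_Ico_sub (fun i : ℕ => V i) hpq
  rw [Finset.sum_add_distrib, ← Finset.mul_sum, ← Finset.sum_filter, ← Finset.mul_sum]
  have hfil : Finset.filter (fun i => M + 1 - J ≤ i) (Finset.range (M + 1)) =
      Finset.Ico (M + 1 - J) (M + 1) := by
    ext i; simp only [Finset.mem_filter, Finset.mem_range, Finset.mem_Ico]; omega
  rw [hfil, htel _ _ (by omega), Finset.range_eq_Ico, htel _ _ (by omega)]
  refine add_le_add (mul_le_mul_of_nonneg_left ?_ (add_nonneg hμ (hpos J).le))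
    (mul_le_mul_of_nonneg_left ?_ (hpos 0).le)
  · have := hmono (hcast (M + 1) hM) (hcast N le_rfl) (by exact_mod_cast hM)
    simpa using this
  · refine hε _ (hcast _ (by omega)) _ (hcast _ hM) (by exact_mod_cast Nat.sub_le _ _) ?_
    have : M + 1 ≤ M + 1 - J + J := by omega
    exact_mod_cast this

/-- The L1 solutions with step sizes `1 / m` converge to a given solution of the continuous
problem. -/
theorem tendsto_discreteSol (hα0 : 0 < α) (hα1 : α < 1) (hμ : 0 ≤ μ)
    (h : IsIntegratedSol α μ N w) {V : ℝ → ℝ} (hV : IsVariationBound N w V) {s : ℝ}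
    (hs : s ∈ Icc (0 : ℝ) N) :
    Filter.Tendsto (fun m : ℕ => w 0 * discreteSol α (μ * ((m : ℝ)⁻¹) ^ α) ⌊s * m⌋₊)
      Filter.atTop (nhds (w s)) := by
  have hinv : Filter.Tendsto (fun m : ℕ => ((m : ℝ)⁻¹)) Filter.atTop (nhds 0) :=
    tendsto_inv_atTop_nhds_zero_nat
  have hb := weight_pos hα0 hα1
  have hN0 : (0 : ℝ) ∈ Icc (0 : ℝ) N := ⟨le_rfl, N.cast_nonneg⟩
  have hΔ : 0 ≤ V N - V 0 :=
    sub_nonneg.2 (hV.monotoneOn hN0 ⟨N.cast_nonneg, le_rfl⟩ N.cast_nonneg)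
  -- The floor of `s m` divided by `m` tends to `s` inside the time interval.
  have hfloor : Filter.Tendsto (fun m : ℕ => w ((m : ℝ)⁻¹ * ⌊s * m⌋₊)) Filter.atTop
      (nhds (w s)) := by
    refine (h.continuousOn s hs).tendsto.comp (tendsto_nhdsWithin_iff.2 ⟨?_, ?_⟩)
    · have := (tendsto_nat_floor_mul_div_atTop hs.1).comp tendsto_natCast_atTop_atTop
      refine this.congr fun m => ?_
      simp [div_eq_inv_mul]
    · filter_upwards [Filter.eventually_gt_atTop 0] with m hm
      have hm : (0 : ℝ) < m := by exact_mod_cast hm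
      refine ⟨by positivity, ?_⟩
      rw [inv_mul_le_iff₀ hm]
      exact (Nat.floor_le (by have := hs.1; positivity)).trans
        (by nlinarith [hs.2])
  have hdiff : Filter.Tendsto (fun m : ℕ => w ((m : ℝ)⁻¹ * ⌊s * m⌋₊)
      - w 0 * discreteSol α (μ * ((m : ℝ)⁻¹) ^ α) ⌊s * m⌋₊) Filter.atTop (nhds 0) := by
    rw [Metric.tendsto_atTop']
    intro ε hε
    set c := 2 * (weight α 0)⁻¹ with hc
    have hc0 : 0 < c := mul_pos two_pos (inv_pos.2 (hb 0))
    obtain ⟨J, hJ⟩ : ∃ J, weight α J * (c * (V N - V 0)) < ε / 3 := by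
      have := (tendsto_weight hα0 hα1).mul_const (c * (V N - V 0))
      rw [zero_mul] at this
      exact (this.eventually_lt_const (by positivity)).exists
    obtain ⟨δ, hδ, hVδ⟩ := Metric.uniformContinuousOn_iff.1
      (isCompact_Icc.uniformContinuousOn_of_continuous hV.continuousOn) (ε / 9) (by positivity)
    have hμm : ∀ᶠ m : ℕ in Filter.atTop, μ * ((m : ℝ)⁻¹) ^ α * (c * (V N - V 0)) < ε / 3 := by
      have h1 : Filter.Tendsto (fun m : ℕ => ((m : ℝ)⁻¹) ^ α) Filter.atTop (nhds 0) := by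
        simpa [Real.zero_rpow hα0.ne'] using hinv.rpow_const (Or.inr hα0.le)
      have := (h1.const_mul μ).mul_const (c * (V N - V 0))
      rw [mul_zero, zero_mul] at this
      exact this.eventually_lt_const (by positivity)
    have hJm : ∀ᶠ m : ℕ in Filter.atTop, (J : ℝ) * (m : ℝ)⁻¹ < δ := by
      have := hinv.const_mul (J : ℝ)
      rw [mul_zero] at this
      exact this.eventually_lt_const hδ
    obtain ⟨m₀, hm₀⟩ := Filter.eventually_atTop.1
      ((hμm.and hJm).and (Filter.eventually_gt_atTop 0))
    refine ⟨m₀, fun m hm => ?_⟩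
    obtain ⟨⟨h1, h2⟩, hmpos⟩ := hm₀ m hm.le
    have hmR : (0 : ℝ) < m := by exact_mod_cast hmpos
    rw [Real.dist_eq, sub_zero]
    have hNm : ((N * m : ℕ) : ℝ) * (m : ℝ)⁻¹ = N := by
      push_cast; rw [mul_inv_cancel_right₀ hmR.ne']
    have hsol := h.comp_mul (inv_pos.2 hmR) hNm
    have hvar := hV.comp_mul (inv_pos.2 hmR) hNm
    have hμ' : 0 ≤ μ * ((m : ℝ)⁻¹) ^ α := by positivity
    have hle : ⌊s * m⌋₊ ≤ N * m := by
      refine Nat.floor_le_of_le ?_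
      push_cast
      exact mul_le_mul_of_nonneg_right hs.2 hmR.le
    rcases Nat.eq_zero_or_pos ⌊s * m⌋₊ with h0 | hpos
    · rw [h0]; simpa [discreteSol] using hε
    obtain ⟨n, hn⟩ : ∃ n, ⌊s * m⌋₊ = n + 1 := ⟨⌊s * m⌋₊ - 1, by omega⟩
    have hbound := abs_error_le hα0 hα1 hμ' hsol
      (isSummedSol_mul_discreteSol hα0 hα1 hμ' (w 0)) (by simp [discreteSol])
      (fun M hM => abs_summedDefect_le hα0 hα1 hμ' hvar (J := J) (ε := ε / 9)
        (fun p hp q hq hpq hqp => by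
          have hmem : ∀ p ∈ Icc (0 : ℝ) ((N * m : ℕ) : ℝ), (m : ℝ)⁻¹ * p ∈ Icc (0 : ℝ) N :=
            fun p hp => ⟨mul_nonneg (inv_pos.2 hmR).le hp.1, by
              rw [← hNm, mul_comm]
              exact mul_le_mul_of_nonneg_right hp.2 (inv_pos.2 hmR).le⟩
          refine (le_abs_self _).trans (hVδ _ (hmem q hq) _ (hmem p hp) ?_).le
          rw [Real.dist_eq, ← mul_sub, abs_of_nonneg
            (mul_nonneg (inv_pos.2 hmR).le (sub_nonneg.2 hpq)), mul_comm]
          refine lt_of_le_of_lt ?_ h2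
          exact mul_le_mul_of_nonneg_right (by linarith) (inv_pos.2 hmR).le) hM)
      (n := n) (by omega)
    rw [hn]
    push_cast
    refine lt_of_le_of_lt hbound ?_
    rw [mul_comm _ ((N * m : ℕ) : ℝ), hNm, mul_zero, ← hc]
    have hcb : c * (weight α 0 * (ε / 9)) = 2 * ε / 9 := by
      rw [hc]; field_simp [(hb 0).ne']
    linarith
  simpa using hfloor.sub hdiff

end

/-! ### Shape of the continuous solution -/

section

variable {α μ : ℝ} {N : ℕ} {w : ℝ → ℝ}

theorem IsIntegratedSol.nonneg (hα0 : 0 < α) (hα1 : α < 1) (hμ : 0 ≤ μ)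
    (h : IsIntegratedSol α μ N w) {V : ℝ → ℝ} (hV : IsVariationBound N w V) (h0 : 0 ≤ w 0) {s : ℝ}
    (hs : s ∈ Icc (0 : ℝ) N) : 0 ≤ w s :=
  ge_of_tendsto' (tendsto_discreteSol hα0 hα1 hμ h hV hs) fun m =>
    mul_nonneg h0 (discreteSol_nonneg hα0 hα1 (by positivity) _)

theorem IsIntegratedSol.antitoneOn (hα0 : 0 < α) (hα1 : α < 1) (hμ : 0 ≤ μ)
    (h : IsIntegratedSol α μ N w) {V : ℝ → ℝ} (hV : IsVariationBound N w V) (h0 : 0 ≤ w 0) :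
    AntitoneOn w (Icc (0 : ℝ) N) := fun s hs t ht hst =>
  le_of_tendsto_of_tendsto' (tendsto_discreteSol hα0 hα1 hμ h hV ht)
    (tendsto_discreteSol hα0 hα1 hμ h hV hs) fun m => by
      refine mul_le_mul_of_nonneg_left ?_ h0
      exact discreteSol_antitone hα0 hα1 (by positivity) (Nat.floor_le_floor (by gcongr))

/-- Convexity of the solution, in the form needed for unit steps. -/
theorem IsIntegratedSol.sub_succ_le (hα0 : 0 < α) (hα1 : α < 1) (hμ : 0 ≤ μ)
    (h : IsIntegratedSol α μ N w) {V : ℝ → ℝ} (hV : IsVariationBound N w V) (h0 : 0 ≤ w 0)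
    {s t : ℝ} (hs : 0 ≤ s) (hst : s ≤ t) (ht : t + 1 ≤ N) :
    w (s + 1) - w (t + 1) ≤ w s - w t := by
  have hlim := fun {r : ℝ} (hr : r ∈ Icc (0 : ℝ) N) => tendsto_discreteSol hα0 hα1 hμ h hV hr
  refine le_of_tendsto_of_tendsto'
    ((hlim (r := s + 1) ⟨by linarith, by linarith⟩).sub
      (hlim (r := t + 1) ⟨by linarith, by linarith⟩))
    ((hlim (r := s) ⟨by linarith, by linarith⟩).sub
      (hlim (r := t) ⟨by linarith, by linarith⟩)) fun m => ?_
  have hfl : ∀ r : ℝ, 0 ≤ r → ⌊(r + 1) * m⌋₊ = ⌊r * m⌋₊ + m := fun r hr => by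
    rw [add_mul, one_mul, Nat.floor_add_natCast (by positivity)]
  rw [hfl s hs, hfl t (hs.trans hst), ← mul_sub, ← mul_sub]
  refine mul_le_mul_of_nonneg_left ?_ h0
  exact discreteSol_sub_antitone hα0 hα1 (by positivity) (Nat.floor_le_floor (by gcongr)) m

/-- The drop of the solution over the first unit step is `O(μ)`. -/
theorem IsIntegratedSol.sub_one_le (hα0 : 0 < α) (hα1 : α < 1) (hμ : 0 ≤ μ)
    (h : IsIntegratedSol α μ N w) {V : ℝ → ℝ} (hV : IsVariationBound N w V) (h0 : 0 ≤ w 0)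
    (hN : 1 ≤ N) : w 0 - w 1 ≤ μ * (Real.Gamma (1 - α) * w 0) := by
  have h1 := (tendsto_discreteSol hα0 hα1 hμ h hV (s := 1)
    ⟨zero_le_one, by exact_mod_cast hN⟩).const_sub (w 0)
  refine le_of_tendsto h1 ?_
  filter_upwards [Filter.eventually_ge_atTop 1] with m hm
  have hm0 : (0 : ℝ) < m := by exact_mod_cast hm
  have h2 := one_sub_discreteSol_le hα0 hα1 (μ := μ * ((m : ℝ)⁻¹) ^ α) (by positivity) hm
  have h3 : ((m : ℝ)⁻¹) ^ α * (m : ℝ) ^ α = 1 := by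
    rw [← Real.mul_rpow (by positivity) hm0.le, inv_mul_cancel₀ hm0.ne', Real.one_rpow]
  rw [one_mul, Nat.floor_natCast]
  have h4 := mul_le_mul_of_nonneg_left h2 h0
  linear_combination h4 + (w 0 * μ * Real.Gamma (1 - α)) * h3

/-! ### The error estimate -/

/-- Summation by parts moves a factor `1 - z` from the reciprocal of `a` to `φ`. -/
theorem sum_recipSeq_mul_conv {a : ℕ → ℝ} (ha : a 0 ≠ 0) (q φ : ℕ → ℝ) (n : ℕ) :
    ∑ M ∈ Finset.range (n + 1), recipSeq a (n - M) *
      ∑ i ∈ Finset.range (M + 1), (a (M - i) + q (M - i)) * φ i =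
    φ n + ∑ i ∈ Finset.range (n + 1),
      (∑ j ∈ Finset.range (n - i + 1), resolventSeq a (n - i - j) * q j) *
        (φ i - if i = 0 then 0 else φ (i - 1)) := by
  have hD : (PowerSeries.mk fun M => ∑ i ∈ Finset.range (M + 1),
      (a (M - i) + q (M - i)) * φ i) =
      PowerSeries.mk φ * (PowerSeries.mk a + PowerSeries.mk q) := by
    ext M
    rw [PowerSeries.coeff_mul, Finset.Nat.sum_antidiagonal_eq_sum_range_succ_mk]
    simp [mul_comm]
  have hc : (PowerSeries.mk fun m => ∑ j ∈ Finset.range (m + 1), resolventSeq a (m - j) * q j) =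
      PowerSeries.mk q * PowerSeries.mk (resolventSeq a) := by
    ext M
    rw [PowerSeries.coeff_mul, Finset.Nat.sum_antidiagonal_eq_sum_range_succ_mk]
    simp [mul_comm]
  have hψ : (PowerSeries.mk fun i => φ i - if i = 0 then 0 else φ (i - 1)) =
      PowerSeries.mk φ * (1 - PowerSeries.X) := by
    ext M
    rw [mul_sub, mul_one, map_sub]
    rcases M with _ | M
    · simp
    · simp [PowerSeries.coeff_succ_mul_X]
  have key : (PowerSeries.mk fun M => ∑ i ∈ Finset.range (M + 1),
      (a (M - i) + q (M - i)) * φ i) * PowerSeries.mk (recipSeq a) = PowerSeries.mk φ +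
      (PowerSeries.mk fun i => φ i - if i = 0 then 0 else φ (i - 1)) *
      (PowerSeries.mk fun m => ∑ j ∈ Finset.range (m + 1), resolventSeq a (m - j) * q j) := by
    rw [hD, hc, hψ]
    linear_combination PowerSeries.mk φ * mk_mul_recipSeq ha
      - PowerSeries.mk φ * PowerSeries.mk q * mk_resolventSeq_mul_one_sub a
  have h := congrArg (PowerSeries.coeff n) key
  rw [map_add, PowerSeries.coeff_mul, PowerSeries.coeff_mul,
    Finset.Nat.sum_antidiagonal_eq_sum_range_succ_mk,
    Finset.Nat.sum_antidiagonal_eq_sum_range_succ_mk] at h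
  simp only [PowerSeries.coeff_mk] at h
  calc _ = _ := Finset.sum_congr rfl fun M _ => mul_comm _ _
    _ = _ := h
    _ = _ := congrArg (φ n + ·) (Finset.sum_congr rfl fun M _ => mul_comm _ _)

theorem abs_resolvent_conv_le {a : ℕ → ℝ} (hpos : ∀ n, 0 < a n)
    (hlc : ∀ n, a (n + 1) ^ 2 ≤ a n * a (n + 2)) (hanti : Antitone a) {q : ℕ → ℝ} {G : ℝ} {m : ℕ}
    (hG : ∑ j ∈ Finset.range (m + 1), |q j| ≤ G) :
    |∑ j ∈ Finset.range (m + 1), resolventSeq a (m - j) * q j| ≤ (a 0)⁻¹ * G := by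
  have h0 := inv_pos.2 (hpos 0)
  calc _ ≤ ∑ j ∈ Finset.range (m + 1), |resolventSeq a (m - j) * q j| :=
        Finset.abs_sum_le_sum_abs _ _
    _ ≤ ∑ j ∈ Finset.range (m + 1), (a 0)⁻¹ * |q j| := by
        refine Finset.sum_le_sum fun j _ => ?_
        rw [abs_mul, abs_of_nonneg (resolventSeq_nonneg hpos hlc hanti _), ← resolventSeq_zero]
        exact mul_le_mul_of_nonneg_right (resolventSeq_antitone hpos hlc (Nat.zero_le _))
          (abs_nonneg _)
    _ ≤ (a 0)⁻¹ * G := by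
        rw [← Finset.mul_sum]
        exact mul_le_mul_of_nonneg_left hG h0.le

/-- Decay of the convolution of the resolvent with `q`: the factor `m + 1` is split as
`(m - j + 1) + j` between the two factors. -/
theorem mul_abs_resolvent_conv_le {a : ℕ → ℝ} (hpos : ∀ n, 0 < a n)
    (hlc : ∀ n, a (n + 1) ^ 2 ≤ a n * a (n + 2)) (hanti : Antitone a) (hμ : 0 ≤ μ)
    (hμa : ∀ n, μ ≤ a n) {q : ℕ → ℝ} {G H : ℝ} {m : ℕ}
    (hG : ∑ j ∈ Finset.range (m + 1), |q j| ≤ G) (hH : ∀ j, j * |q j| ≤ H) :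
    μ * ((m + 1) * |∑ j ∈ Finset.range (m + 1), resolventSeq a (m - j) * q j|) ≤ G + H := by
  have hK := resolventSeq_nonneg hpos hlc hanti
  have hH0 : 0 ≤ H := by simpa using hH 0
  calc _ ≤ μ * ((m + 1) * ∑ j ∈ Finset.range (m + 1), |resolventSeq a (m - j) * q j|) := by
        gcongr
        exact Finset.abs_sum_le_sum_abs _ _
    _ = ∑ j ∈ Finset.range (m + 1),
          (μ * (((m - j : ℕ) + 1) * resolventSeq a (m - j)) * |q j|
            + μ * resolventSeq a (m - j) * (j * |q j|)) := by
        rw [Finset.mul_sum, Finset.mul_sum]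
        refine Finset.sum_congr rfl fun j hj => ?_
        have hj := Finset.mem_range.1 hj
        rw [abs_mul, abs_of_nonneg (hK _), Nat.cast_sub (by omega)]
        ring
    _ ≤ ∑ j ∈ Finset.range (m + 1), (1 * |q j| + μ * resolventSeq a (m - j) * H) := by
        refine Finset.sum_le_sum fun j _ => add_le_add ?_ ?_
        · exact mul_le_mul_of_nonneg_right (mul_resolventSeq_le hpos hlc hanti hμ (hμa _))
            (abs_nonneg _)
        · exact mul_le_mul_of_nonneg_left (hH j) (mul_nonneg hμ (hK _))
    _ = ∑ j ∈ Finset.range (m + 1), |q j|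
          + (μ * ∑ j ∈ Finset.range (m + 1), resolventSeq a j) * H := by
        rw [Finset.sum_add_distrib, ← Finset.sum_mul, ← Finset.mul_sum]
        simp only [one_mul]
        rw [← Finset.sum_range_reflect (resolventSeq a) (m + 1), Finset.mul_sum]
        rfl
    _ ≤ G + 1 * H := by
        gcongr
        exact mul_sum_resolventSeq_le hpos hlc hanti (hμa m)
    _ = G + H := by rw [one_mul]

/-- The algebraic core of the error estimate: the reciprocal of `a` applied to the convolution of
a perturbation of `a` with a decreasing sequence is `O(1 / n)`. -/
theorem mul_abs_recip_conv_le {a : ℕ → ℝ} (hpos : ∀ n, 0 < a n)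
    (hlc : ∀ n, a (n + 1) ^ 2 ≤ a n * a (n + 2)) (hanti : Antitone a) (hμ : 0 ≤ μ)
    (hμa : ∀ n, μ ≤ a n) {q φ : ℕ → ℝ} {G H S p : ℝ} {n : ℕ}
    (hG : ∀ m, ∑ j ∈ Finset.range (m + 1), |q j| ≤ G) (hH : ∀ j, j * |q j| ≤ H)
    (hφ0 : ∀ i ≤ n, 0 ≤ φ i) (hφ : ∀ i < n, φ (i + 1) ≤ φ i) (hp : φ 0 ≤ μ * p)
    (hp0 : 0 ≤ p) (hS : ∑ i ∈ Finset.range (n + 1), φ i ≤ S) :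
    (n + 1) * |∑ M ∈ Finset.range (n + 1), recipSeq a (n - M) *
      ∑ i ∈ Finset.range (M + 1), (a (M - i) + q (M - i)) * φ i| ≤
    S + 2 * p * (G + H) + (a 0)⁻¹ * G * S := by
  have hG0 : 0 ≤ G := (Finset.sum_nonneg fun _ _ => abs_nonneg _).trans (hG 0)
  have hH0 : 0 ≤ H := by simpa using hH 0
  have ha0 := inv_pos.2 (hpos 0)
  set c : ℕ → ℝ := fun m => ∑ j ∈ Finset.range (m + 1), resolventSeq a (m - j) * q j with hc
  set ψ : ℕ → ℝ := fun i => φ i - if i = 0 then 0 else φ (i - 1) with hψ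
  have hψ0 : ψ 0 = φ 0 := by simp [hψ]
  have hψs : ∀ i, ψ (i + 1) = φ (i + 1) - φ i := fun i => by simp [hψ]
  have habs : ∀ i < n, |ψ (i + 1)| = φ i - φ (i + 1) := fun i hi => by
    rw [hψs, abs_of_nonpos (by linarith [hφ i hi])]; ring
  have hn : (n + 1) * φ n ≤ S := by
    refine le_trans ?_ hS
    have hle : ∀ i ≤ n, φ n ≤ φ i := fun i hi =>
      Nat.decreasingInduction' (P := fun i => φ n ≤ φ i)
        (fun k hk _ ih => ih.trans (hφ k hk)) hi le_rfl
    have := Finset.card_nsmul_le_sum (Finset.range (n + 1)) φ (φ n)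
      fun i hi => hle i (Nat.lt_succ_iff.1 (Finset.mem_range.1 hi))
    simpa using this
  have hsum0 : ∑ i ∈ Finset.range (n + 1), |ψ i| ≤ 2 * (μ * p) := by
    rw [Finset.sum_range_succ', hψ0, abs_of_nonneg (hφ0 0 (Nat.zero_le _)),
      Finset.sum_congr rfl fun i hi => habs i (Finset.mem_range.1 hi), Finset.sum_range_sub']
    linarith [hφ0 n le_rfl]
  have hsum1 : ∑ i ∈ Finset.range (n + 1), i * |ψ i| ≤ S := by
    refine le_trans ?_ hS
    have : ∀ m ≤ n, ∑ i ∈ Finset.range (m + 1), i * |ψ i| + (m + 1) * φ m =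
        ∑ i ∈ Finset.range (m + 1), φ i := by
      intro m
      induction m with
      | zero => simp
      | succ m ih =>
        intro hm
        rw [Finset.sum_range_succ, Finset.sum_range_succ φ, ← ih (by omega), habs m (by omega)]
        push_cast
        ring
    have h1 := this n le_rfl
    have := mul_nonneg (by positivity : (0 : ℝ) ≤ n + 1) (hφ0 n le_rfl)
    linarith
  -- The bound for `(m + 1) |c m|` carries a factor `1 / μ`, compensated by `φ 0 ≤ μ p`.
  have hfirst : ∑ i ∈ Finset.range (n + 1), (((n - i : ℕ) : ℝ) + 1) * |c (n - i)| * |ψ i| ≤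
      2 * p * (G + H) := by
    rcases hμ.eq_or_lt with rfl | hμ'
    · have hz : ∀ i ∈ Finset.range (n + 1), |ψ i| = 0 :=
        (Finset.sum_eq_zero_iff_of_nonneg fun _ _ => abs_nonneg _).1
          (le_antisymm (by simpa using hsum0) (Finset.sum_nonneg fun _ _ => abs_nonneg _))
      rw [Finset.sum_eq_zero fun i hi => by rw [hz i hi, mul_zero]]
      positivity
    · calc _ ≤ ∑ i ∈ Finset.range (n + 1), (G + H) / μ * |ψ i| := by
            refine Finset.sum_le_sum fun i _ => mul_le_mul_of_nonneg_right ?_ (abs_nonneg _)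
            rw [le_div_iff₀' hμ']
            exact mul_abs_resolvent_conv_le hpos hlc hanti hμ hμa (hG _) hH
        _ ≤ (G + H) / μ * (2 * (μ * p)) := by
            rw [← Finset.mul_sum]
            exact mul_le_mul_of_nonneg_left hsum0 (by positivity)
        _ = 2 * p * (G + H) := by field_simp
  have hsecond : ∑ i ∈ Finset.range (n + 1), |c (n - i)| * (i * |ψ i|) ≤ (a 0)⁻¹ * G * S := by
    calc _ ≤ ∑ i ∈ Finset.range (n + 1), (a 0)⁻¹ * G * (i * |ψ i|) := by
          refine Finset.sum_le_sum fun i _ => mul_le_mul_of_nonneg_right ?_ (by positivity)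
          exact abs_resolvent_conv_le hpos hlc hanti (hG _)
      _ ≤ (a 0)⁻¹ * G * S := by
          rw [← Finset.mul_sum]
          exact mul_le_mul_of_nonneg_left hsum1 (by positivity)
  rw [sum_recipSeq_mul_conv (hpos 0).ne']
  calc (n + 1 : ℝ) * |φ n + ∑ i ∈ Finset.range (n + 1), c (n - i) * ψ i|
      ≤ (n + 1) * (φ n + ∑ i ∈ Finset.range (n + 1), |c (n - i) * ψ i|) := by
        gcongr
        refine (abs_add_le _ _).trans (add_le_add (abs_of_nonneg (hφ0 n le_rfl)).le ?_)
        exact Finset.abs_sum_le_sum_abs _ _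
    _ = (n + 1) * φ n + (∑ i ∈ Finset.range (n + 1),
          (((n - i : ℕ) : ℝ) + 1) * |c (n - i)| * |ψ i|
          + ∑ i ∈ Finset.range (n + 1), |c (n - i)| * (i * |ψ i|)) := by
        rw [mul_add, Finset.mul_sum, ← Finset.sum_add_distrib]
        congr 1
        refine Finset.sum_congr rfl fun i hi => ?_
        have hi := Finset.mem_range.1 hi
        rw [abs_mul, Nat.cast_sub (by omega)]
        ring
    _ ≤ _ := by linarith

theorem sum_abs_fracKernel_sub_weight_le (hα0 : 0 < α) (hα1 : α < 1) {x : ℝ} (hx0 : 0 < x)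
    (hx1 : x ≤ 1) (m : ℕ) :
    ∑ j ∈ Finset.range (m + 1), |fracKernel α (j + x) - weight α j| ≤
      fracKernel α x + weight α 0 + fracKernel α 1 := by
  have h1 : ∀ j ∈ Finset.range m, |fracKernel α ((j + 1 : ℕ) + x) - weight α (j + 1)| ≤
      fracKernel α ((j : ℕ) + 1) - fracKernel α ((j + 1 : ℕ) + 1) := by
    intro j _
    have e1 := weight_le hα0 hα1 (Nat.le_add_left 1 j)
    have e2 := le_weight hα0 hα1 (j + 1)
    have e3 : fracKernel α ((j + 1 : ℕ) + x) ≤ fracKernel α ((j + 1 : ℕ) : ℝ) :=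
      fracKernel_anti hα0 hα1 (by positivity) (by linarith)
    have e4 : fracKernel α ((j + 1 : ℕ) + 1) ≤ fracKernel α ((j + 1 : ℕ) + x) :=
      fracKernel_anti hα0 hα1 (by positivity) (by linarith)
    push_cast at *
    rw [abs_le]
    constructor <;> linarith
  rw [Finset.sum_range_succ']
  have h2 := Finset.sum_le_sum h1
  rw [Finset.sum_range_sub' (fun j : ℕ => fracKernel α (j + 1))] at h2
  have h3 := fracKernel_pos hα1 (x := (m : ℝ) + 1) (by positivity)
  have h4 : |fracKernel α ((0 : ℕ) + x) - weight α 0| ≤ fracKernel α x + weight α 0 := by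
    have e1 := fracKernel_pos hα1 hx0
    have e2 := weight_pos hα0 hα1 0
    rw [Nat.cast_zero, zero_add, abs_le]
    constructor <;> linarith
  rw [Nat.cast_zero, zero_add] at h2
  linarith

theorem mul_abs_fracKernel_sub_weight_le (hα0 : 0 < α) (hα1 : α < 1) {x : ℝ} (hx0 : 0 < x)
    (hx1 : x ≤ 1) (j : ℕ) :
    j * |fracKernel α (j + x) - weight α j| ≤ (Real.Gamma (1 - α))⁻¹ := by
  rcases Nat.eq_zero_or_pos j with rfl | hj
  · simpa using (gamma_pos hα1).le
  have hj1 : (1 : ℝ) ≤ j := by exact_mod_cast hj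
  refine le_trans (mul_le_mul_of_nonneg_left ?_ (by positivity)) (mul_fracKernel_sub_le hα0 hα1 hj1)
  have e1 := weight_le hα0 hα1 hj
  have e2 := le_weight hα0 hα1 j
  have e3 : fracKernel α (j + x) ≤ fracKernel α j :=
    fracKernel_anti hα0 hα1 (by positivity) (by linarith)
  have e4 : fracKernel α (j + 1) ≤ fracKernel α (j + x) :=
    fracKernel_anti hα0 hα1 (by positivity) (by linarith)
  rw [abs_le]
  constructor <;> linarith

/-- The constant of the scalar error estimate; it depends on `α` only. -/
def errorConst (α : ℝ) : ℝ :=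
  1 + 2 * Real.Gamma (1 - α) * (2 * weight α 0 + fracKernel α 1 + (Real.Gamma (1 - α))⁻¹)
    + (weight α 0)⁻¹ * (2 * weight α 0 + fracKernel α 1)

theorem one_le_errorConst (hα0 : 0 < α) (hα1 : α < 1) : 1 ≤ errorConst α := by
  have h1 := weight_pos hα0 hα1 0
  have h2 := gamma_pos hα1
  have h3 := fracKernel_pos hα1 one_pos
  have : 0 ≤ 2 * Real.Gamma (1 - α) * (2 * weight α 0 + fracKernel α 1 + (Real.Gamma (1 - α))⁻¹)
    + (weight α 0)⁻¹ * (2 * weight α 0 + fracKernel α 1) := by positivity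
  unfold errorConst
  linarith

/-- The scalar error estimate for nonnegative initial values. By `error_eq` the error is an integral
over `x ∈ [0, 1]` of convolutions to which `mul_abs_recip_conv_le` applies, with
`q j = k (j + x) - b j` and `φ i = w (i + 1 - x) - w (i + 1)`; the sequence `φ` decreases because
`w` is convex. -/
theorem mul_abs_error_le_of_nonneg (hα0 : 0 < α) (hα1 : α < 1) (hμ : 0 ≤ μ)
    (h : IsIntegratedSol α μ N w) {V : ℝ → ℝ} (hV : IsVariationBound N w V) (hw0 : 0 ≤ w 0)
    {U : ℕ → ℝ} (hU : IsSummedSol α μ N U) (h0 : U 0 = w 0) {n : ℕ} (hn : n < N) :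
    (n + 1) * |w (n + 1) - U (n + 1)| ≤ errorConst α * w 0 := by
  have hpos := summedWeight_pos hα0 hα1 hμ
  have hΓ := gamma_pos hα1
  have hcast : ∀ i ≤ N, (i : ℝ) ∈ Icc (0 : ℝ) N := fun i hi =>
    ⟨i.cast_nonneg, by exact_mod_cast hi⟩
  have hanti := h.antitoneOn hα0 hα1 hμ hV hw0
  have hnonneg := fun {s : ℝ} (hs : s ∈ Icc (0 : ℝ) N) => h.nonneg hα0 hα1 hμ hV hw0 hs
  set a := summedWeight α μ with ha
  set F : ℝ → ℝ := fun x => ∑ M ∈ Finset.range (n + 1), recipSeq a (n - M) *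
    ∑ i ∈ Finset.range (M + 1), (fracKernel α ((M - i : ℕ) + x) + μ) *
      (w (i + 1 - x) - w (i + 1)) with hF
  have hint : ∀ M ∈ Finset.range (n + 1), ∀ i ∈ Finset.range (M + 1), IntervalIntegrable
      (fun x => (fracKernel α ((M - i : ℕ) + x) + μ) * (w (i + 1 - x) - w (i + 1)))
      volume 0 1 := by
    intro M hM i hi
    have hM := Finset.mem_range.1 hM
    have hi := Finset.mem_range.1 hi
    exact ((intervalIntegrable_fracKernel_add hα1 ((M - i : ℕ) : ℝ) 0 1).add
      (intervalIntegrable_const (c := μ))).mul_continuousOn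
      ((continuousOn_reflected h.continuousOn (by omega)).sub continuousOn_const)
  have herr : w (n + 1) - U (n + 1) = -∫ x in (0 : ℝ)..1, F x := by
    have hsum : ∀ M ∈ Finset.range (n + 1), IntervalIntegrable (fun x =>
        ∑ i ∈ Finset.range (M + 1), (fracKernel α ((M - i : ℕ) + x) + μ) *
        (w (i + 1 - x) - w (i + 1))) volume 0 1 := fun M hM => by
      simpa only [Finset.sum_fn] using IntervalIntegrable.sum _ (hint M hM)
    rw [error_eq hα0 hα1 hμ h hU h0 hn, hF,
      intervalIntegral.integral_finsetSum fun M hM => (hsum M hM).const_mul _]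
    congr 1
    refine Finset.sum_congr rfl fun M hM => ?_
    rw [intervalIntegral.integral_const_mul, summedDefect,
      intervalIntegral.integral_finsetSum (hint M hM)]
  set Q : ℝ → ℝ := fun x => w 0 + 2 * (Real.Gamma (1 - α) * w 0) *
    ((fracKernel α x + weight α 0 + fracKernel α 1) + (Real.Gamma (1 - α))⁻¹)
    + (weight α 0)⁻¹ * (fracKernel α x + weight α 0 + fracKernel α 1) * w 0 with hQ
  have hpt : ∀ x ∈ Ioc (0 : ℝ) 1, (n + 1) * |F x| ≤ Q x := by
    intro x hx
    have hx' : x ∈ Icc (0 : ℝ) 1 := ⟨hx.1.le, hx.2⟩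
    set φ : ℕ → ℝ := fun i => w (i + 1 - x) - w (i + 1) with hφ
    have hφle : ∀ i < N, φ i ≤ w i - w (i + 1) := fun i hi => by
      have := hanti (hcast i hi.le) (reflected_mem hi hx') (by linarith [hx.2])
      simp only [hφ]; linarith
    have h1 := mul_abs_recip_conv_le (μ := μ) hpos (summedWeight_logConvex hα0 hα1 hμ)
      (summedWeight_antitone hα0 hα1) hμ
      (fun j => by simpa [ha, summedWeight] using (weight_pos hα0 hα1 j).le)
      (q := fun j => fracKernel α (j + x) - weight α j) (φ := φ)
      (p := Real.Gamma (1 - α) * w 0) (S := w 0) (n := n)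
      (sum_abs_fracKernel_sub_weight_le hα0 hα1 hx.1 hx.2)
      (mul_abs_fracKernel_sub_weight_le hα0 hα1 hx.1 hx.2)
      (fun i hi => by
        have := hanti (reflected_mem (show i < N by omega) hx') (hcast (i + 1) (by omega))
          (by push_cast; linarith [hx.1])
        push_cast at this
        simp only [hφ]; linarith)
      (fun i hi => by
        have hiN : (i : ℝ) + 1 + 1 ≤ N := by
          have : i + 1 + 1 ≤ N := by omega
          exact_mod_cast this
        have := h.sub_succ_le hα0 hα1 hμ hV hw0 (s := i + 1 - x) (t := i + 1)
          (reflected_mem (show i < N by omega) hx').1 (by linarith [hx.1]) hiN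
        simp only [hφ]
        push_cast
        rwa [show (i : ℝ) + 1 + 1 - x = i + 1 - x + 1 by ring])
      (by
        have e1 := hφle 0 (by omega)
        have e2 := h.sub_one_le hα0 hα1 hμ hV hw0 (by omega)
        simp only [Nat.cast_zero, zero_add] at e1
        exact e1.trans e2)
      (by positivity)
      (by
        refine (Finset.sum_le_sum fun i hi => hφle i (by
          have := Finset.mem_range.1 hi; omega)).trans ?_
        have e1 := Finset.sum_range_sub' (fun i : ℕ => w i) (n + 1)
        push_cast at e1
        rw [e1]
        have := hnonneg (hcast (n + 1) hn)
        push_cast at this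
        linarith)
    have h2 : F x = ∑ M ∈ Finset.range (n + 1), recipSeq a (n - M) *
        ∑ i ∈ Finset.range (M + 1),
          (a (M - i) + (fracKernel α ((M - i : ℕ) + x) - weight α (M - i))) * φ i := by
      refine Finset.sum_congr rfl fun M _ => congrArg (recipSeq a (n - M) * ·)
        (Finset.sum_congr rfl fun i _ => ?_)
      simp only [ha, summedWeight, hφ]
      ring
    rw [h2]
    refine h1.trans ?_
    have hG0 : 0 ≤ fracKernel α x + weight α 0 + fracKernel α 1 :=
      add_nonneg (add_nonneg (fracKernel_pos hα1 hx.1).le (weight_pos hα0 hα1 0).le)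
        (fracKernel_pos hα1 one_pos).le
    have hinv : (summedWeight α μ 0)⁻¹ ≤ (weight α 0)⁻¹ := by
      refine inv_anti₀ (weight_pos hα0 hα1 0) ?_
      simpa [summedWeight] using hμ
    simp only [hQ]
    gcongr
  have hk : IntervalIntegrable (fracKernel α) volume 0 1 := intervalIntegrable_fracKernel hα1 0 1
  have hQeq : Q = fun x => (2 * (Real.Gamma (1 - α) * w 0) + (weight α 0)⁻¹ * w 0) *
      fracKernel α x + (w 0 + 2 * (Real.Gamma (1 - α) * w 0) *
      ((weight α 0 + fracKernel α 1) + (Real.Gamma (1 - α))⁻¹)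
      + (weight α 0)⁻¹ * (weight α 0 + fracKernel α 1) * w 0) := by
    funext x; simp only [hQ]; ring
  have hQint : IntervalIntegrable Q volume 0 1 := by
    rw [hQeq]
    exact (hk.const_mul _).add intervalIntegrable_const
  have hQval : ∫ x in (0 : ℝ)..1, Q x = errorConst α * w 0 := by
    rw [hQeq, intervalIntegral.integral_add (hk.const_mul _) intervalIntegrable_const,
      intervalIntegral.integral_const_mul]
    have := weight_eq_integral hα1 0
    simp only [Nat.cast_zero, zero_add] at this
    rw [← this, intervalIntegral.integral_const, sub_zero, one_smul, errorConst]
    ring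
  have hn0 : (0 : ℝ) ≤ n + 1 := by positivity
  rw [herr, abs_neg, ← hQval, ← abs_of_nonneg hn0, ← abs_mul,
    ← intervalIntegral.integral_const_mul, ← Real.norm_eq_abs]
  refine intervalIntegral.norm_integral_le_of_norm_le zero_le_one
    (Filter.Eventually.of_forall fun x hx => ?_) hQint
  rw [Real.norm_eq_abs, abs_mul, abs_of_nonneg hn0]
  exact hpt x hx

theorem IsSummedSol.neg {U : ℕ → ℝ} (hU : IsSummedSol α μ N U) :
    IsSummedSol α μ N fun n => -U n := by
  intro M hM
  have := hU M hM
  simp only [mul_neg, Finset.sum_neg_distrib, neg_mul]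
  rw [this]

theorem mul_abs_error_le (hα0 : 0 < α) (hα1 : α < 1) (hμ : 0 ≤ μ)
    (h : IsIntegratedSol α μ N w) {V : ℝ → ℝ} (hV : IsVariationBound N w V)
    {U : ℕ → ℝ} (hU : IsSummedSol α μ N U) (h0 : U 0 = w 0) {n : ℕ} (hn : n < N) :
    (n + 1) * |w (n + 1) - U (n + 1)| ≤ errorConst α * |w 0| := by
  rcases le_total 0 (w 0) with hw | hw
  · rw [abs_of_nonneg hw]
    exact mul_abs_error_le_of_nonneg hα0 hα1 hμ h hV hw hU h0 hn
  · have hV' : IsVariationBound N (fun s => -w s) V := ⟨hV.continuousOn, fun s hs t ht hst => by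
      rw [neg_sub_neg, abs_sub_comm]; exact hV.abs_sub_le s hs t ht hst⟩
    have := mul_abs_error_le_of_nonneg hα0 hα1 hμ h.neg hV' (neg_nonneg.2 hw) hU.neg
      (by simp [h0]) hn
    rw [abs_of_nonpos hw, abs_sub_comm]
    rwa [neg_sub_neg] at this

end

/-! ### From the Caputo derivative to the integrated equation -/

section

variable {α : ℝ}

theorem intervalIntegrable_of_mul_rpow (hα0 : 0 < α) {T : ℝ} (hT : 0 < T) {f : ℝ → ℝ}
    (h : IntervalIntegrable (fun s => (T - s) ^ (-α) * f s) volume 0 T) :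
    IntervalIntegrable f volume 0 T := by
  have hc : ContinuousOn (fun s : ℝ => (T - s) ^ α) (uIcc 0 T) :=
    ContinuousOn.rpow_const (by fun_prop) fun _ _ => Or.inr hα0.le
  refine (h.mul_continuousOn hc).congr_ae ?_
  rw [Filter.EventuallyEq, ae_restrict_iff' measurableSet_uIoc]
  filter_upwards [Measure.ae_ne volume T] with s hsT hs
  rw [uIoc_of_le hT.le] at hs
  have h0 : 0 < T - s := sub_pos.2 (lt_of_le_of_ne hs.2 hsT)
  rw [mul_right_comm, ← Real.rpow_add h0, neg_add_cancel, Real.rpow_zero, one_mul]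

/-- A function with integrable derivative has bounded variation: `V t = ∫₀ᵗ |f|`. -/
theorem exists_isVariationBound {T : ℝ} {y f : ℝ → ℝ}
    (hy : ContinuousOn y (Icc 0 T)) (hd : ∀ s ∈ Ioo 0 T, HasDerivAt y (f s) s)
    (hf : IntervalIntegrable f volume 0 T) (hT : 0 < T) : ∃ V, IsVariationBound T y V := by
  have hsub : ∀ s ∈ Icc 0 T, ∀ t ∈ Icc 0 T, IntervalIntegrable f volume s t := fun s hs t ht => by
    refine hf.mono_set ?_
    rw [uIcc_of_le hT.le]
    exact uIcc_subset_Icc hs ht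
  have h0 : (0 : ℝ) ∈ Icc 0 T := ⟨le_rfl, hT.le⟩
  refine ⟨fun t => ∫ s in (0 : ℝ)..t, |f s|, ?_, fun s hs t ht hst => ?_⟩
  · have := intervalIntegral.continuousOn_primitive_interval (a := 0) (b := T)
      ((intervalIntegrable_iff' (by simp)).1 hf.abs)
    rwa [uIcc_of_le hT.le] at this
  · rw [intervalIntegral.integral_interval_sub_left (hsub 0 h0 t ht).abs (hsub 0 h0 s hs).abs,
      ← intervalIntegral.integral_eq_sub_of_hasDerivAt_of_le hst
        (hy.mono (Icc_subset_Icc hs.1 ht.2))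
        (fun r hr => hd r ⟨hs.1.trans_lt hr.1, hr.2.trans_le ht.2⟩) (hsub s hs t ht)]
    exact intervalIntegral.abs_integral_le_integral_abs hst

/-- Integrating `∫₀ʳ k(r - s) f(s) ds` over `r` and exchanging the integrals. -/
theorem integral_integral_fracKernel (hα1 : α < 1) {t : ℝ} (ht : 0 ≤ t) {f : ℝ → ℝ}
    (hf : IntervalIntegrable f volume 0 t) :
    ∫ r in (0 : ℝ)..t, ∫ s in (0 : ℝ)..r, fracKernel α (r - s) * f s =
      ∫ s in (0 : ℝ)..t, (t - s) ^ (1 - α) / Real.Gamma (2 - α) * f s := by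
  set fi : ℝ → ℝ := (Ioc 0 t).indicator f with hfi
  set ki : ℝ → ℝ := (Ioc 0 t).indicator (fracKernel α) with hki
  have hfi' : Integrable fi :=
    ((intervalIntegrable_iff_integrableOn_Ioc_of_le ht).1 hf).integrable_indicator
      measurableSet_Ioc
  have hki' : Integrable ki :=
    ((intervalIntegrable_iff_integrableOn_Ioc_of_le ht).1
      (intervalIntegrable_fracKernel hα1 0 t)).integrable_indicator measurableSet_Ioc
  have hconv : Integrable (Function.uncurry fun r s => fi s * ki (r - s))
      ((volume.restrict (Ioc 0 t)).prod volume) := by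
    have h1 := hfi'.convolution_integrand (ContinuousLinearMap.mul ℝ ℝ) hki'
    have h2 := h1.restrict (s := Ioc 0 t ×ˢ univ)
    rwa [← Measure.prod_restrict, Measure.restrict_univ] at h2
  have hswap := integral_integral_swap hconv
  rw [intervalIntegral.integral_of_le ht, intervalIntegral.integral_of_le ht]
  have hL : ∀ r ∈ Ioc 0 t, ∫ s in (0 : ℝ)..r, fracKernel α (r - s) * f s =
      ∫ s, fi s * ki (r - s) := by
    intro r hr
    rw [intervalIntegral.integral_of_le hr.1.le, integral_Ioc_eq_integral_Ioo,
      ← integral_indicator measurableSet_Ioo]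
    congr 1
    funext s
    by_cases hs : s ∈ Ioo 0 r
    · rw [indicator_of_mem hs, hfi, hki, indicator_of_mem (show s ∈ Ioc 0 t from
        ⟨hs.1, hs.2.le.trans hr.2⟩), indicator_of_mem (show r - s ∈ Ioc 0 t from
        ⟨by linarith [hs.2], by linarith [hs.1, hr.2]⟩), mul_comm]
    · rw [indicator_of_notMem hs]
      by_cases hs0 : 0 < s
      · have : r - s ∉ Ioc 0 t := fun h => hs ⟨hs0, by linarith [h.1]⟩
        rw [hki, indicator_of_notMem this, mul_zero]
      · have : s ∉ Ioc 0 t := fun h => hs0 h.1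
        rw [hfi, indicator_of_notMem this, zero_mul]
  have hR : ∀ s, ∫ r in Ioc 0 t, fi s * ki (r - s) =
      (Ioc 0 t).indicator (fun s => (t - s) ^ (1 - α) / Real.Gamma (2 - α) * f s) s := by
    intro s
    by_cases hs : s ∈ Ioc 0 t
    · rw [indicator_of_mem hs, integral_const_mul, hfi, indicator_of_mem hs, mul_comm]
      congr 1
      have h1 : ∀ r ∈ Ioc 0 t, ki (r - s) =
          (Ioc s t).indicator (fun r => fracKernel α (r - s)) r := by
        intro r hr
        by_cases hrs : r ∈ Ioc s t
        · rw [indicator_of_mem hrs, hki, indicator_of_mem (show r - s ∈ Ioc 0 t from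
            ⟨by linarith [hrs.1], by linarith [hs.1, hr.2]⟩)]
        · have : r - s ∉ Ioc 0 t := fun h => hrs ⟨by linarith [h.1], hr.2⟩
          rw [indicator_of_notMem hrs, hki, indicator_of_notMem this]
      rw [setIntegral_congr_fun measurableSet_Ioc h1, setIntegral_indicator measurableSet_Ioc,
        inter_eq_right.2 (Ioc_subset_Ioc_left hs.1.le), ← intervalIntegral.integral_of_le hs.2,
        intervalIntegral.integral_comp_sub_right (fracKernel α), integral_fracKernel hα1, sub_self,
        Real.zero_rpow (by linarith), sub_zero]
    · rw [indicator_of_notMem hs, hfi, indicator_of_notMem hs]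
      simp
  rw [setIntegral_congr_fun measurableSet_Ioc hL, hswap, ← integral_indicator measurableSet_Ioc]
  congr 1
  funext s
  exact hR s

/-- Integrating the Caputo equation in time and then by parts leaves a Volterra equation in which
the derivative `f` of `y` no longer occurs. -/
theorem isIntegratedSol_of_caputo (hα0 : 0 < α) (hα1 : α < 1) {T l : ℝ}
    {y f : ℝ → ℝ} (hy : ContinuousOn y (Icc 0 T)) (hd : ∀ s ∈ Ioo 0 T, HasDerivAt y (f s) s)
    (hi : ∀ t ∈ Ioc 0 T, IntervalIntegrable (fun s => (t - s) ^ (-α) * f s) volume 0 t)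
    (he : ∀ t ∈ Ioc 0 T, (Real.Gamma (1 - α))⁻¹ * (∫ s in (0 : ℝ)..t, (t - s) ^ (-α) * f s)
      + l * y t = 0) : IsIntegratedSol α l T y := by
  refine ⟨hy, fun t ht => ?_⟩
  rcases ht.1.eq_or_lt with rfl | ht0
  · simp
  have hf : IntervalIntegrable f volume 0 t :=
    intervalIntegrable_of_mul_rpow hα0 ht0 (hi t ⟨ht0, ht.2⟩)
  have hyt : ContinuousOn y (uIcc 0 t) := by
    rw [uIcc_of_le ht.1]; exact hy.mono (Icc_subset_Icc le_rfl ht.2)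
  have h1 : ∫ r in (0 : ℝ)..t, ∫ s in (0 : ℝ)..r, fracKernel α (r - s) * f s =
      -(l * ∫ s in (0 : ℝ)..t, y s) := by
    rw [← intervalIntegral.integral_const_mul, ← intervalIntegral.integral_neg]
    refine intervalIntegral.integral_congr_ae (Filter.Eventually.of_forall fun r hr => ?_)
    rw [uIoc_of_le ht.1] at hr
    have h2 := he r ⟨hr.1, hr.2.trans ht.2⟩
    rw [← intervalIntegral.integral_const_mul] at h2
    refine eq_neg_of_add_eq_zero_left (Eq.trans (congrArg (· + l * y r) ?_) h2)
    refine intervalIntegral.integral_congr fun s _ => ?_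
    simp only [fracKernel]
    ring
  have hΓ := gamma_two_sub hα1
  have hα : 1 - α ≠ 0 := by linarith
  have h2 := intervalIntegral.integral_mul_deriv_eq_deriv_mul_of_hasDerivAt (a := 0) (b := t)
    (u := fun s => (t - s) ^ (1 - α) / Real.Gamma (2 - α)) (v := fun s => y s - y 0)
    (u' := fun s => -fracKernel α (t - s)) (v' := f)
    ((ContinuousOn.rpow_const (by fun_prop) fun _ _ => Or.inr (by linarith)).div_const _)
    (hyt.sub continuousOn_const)
    (fun s hs => by
      rw [min_eq_left ht.1, max_eq_right ht.1] at hs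
      have h3 := (((hasDerivAt_id s).const_sub t).rpow_const (p := 1 - α)
        (Or.inl (sub_pos.2 hs.2).ne')).div_const (Real.Gamma (2 - α))
      refine h3.congr_deriv ?_
      have := (gamma_pos hα1).ne'
      simp only [id, hΓ, fracKernel, show 1 - α - 1 = -α by ring]
      field_simp)
    (fun s hs => by
      rw [min_eq_left ht.1, max_eq_right ht.1] at hs
      exact (hd s ⟨hs.1, hs.2.trans_le ht.2⟩).sub_const _)
    (intervalIntegrable_fracKernel_sub hα1 t 0 t).neg hf
  rw [← integral_integral_fracKernel hα1 ht.1 hf, h1] at h2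
  simp only [sub_self, mul_zero, Real.zero_rpow hα, zero_div, zero_mul, neg_mul,
    intervalIntegral.integral_neg, sub_neg_eq_add, zero_add] at h2
  linarith

/-! ### Reduction to eigenmodes -/

theorem norm_le_of_forall_abs_inner_le {X ι : Type*} [NormedAddCommGroup X]
    [InnerProductSpace ℝ X] [Fintype ι] (e : OrthonormalBasis ι ℝ X) {c : ℝ} (hc : 0 ≤ c) {x y : X}
    (h : ∀ i, |⟪e i, x⟫_ℝ| ≤ c * |⟪e i, y⟫_ℝ|) : ‖x‖ ≤ c * ‖y‖ := by
  refine le_of_sq_le_sq ?_ (by positivity)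
  rw [mul_pow, ← e.sum_sq_norm_inner_right x, ← e.sum_sq_norm_inner_right y, Finset.mul_sum]
  refine Finset.sum_le_sum fun i _ => ?_
  rw [← mul_pow]
  exact pow_le_pow_left₀ (norm_nonneg _) (h i) 2

/-- The spectral theorem for a positive operator, in terms of the coefficient functionals of an
orthonormal basis of eigenvectors. -/
theorem exists_eigenfunctionals {X : Type*} [NormedAddCommGroup X] [InnerProductSpace ℝ X]
    [FiniteDimensional ℝ X] {A : X →ₗ[ℝ] X} (hA : A.IsPositive) :
    ∃ (n : ℕ) (L : Fin n → X →L[ℝ] ℝ) (l : Fin n → ℝ),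
      (∀ i, 0 ≤ l i ∧ ∀ x, L i (A x) = l i * L i x) ∧
      ∀ (c : ℝ) (x y : X), 0 ≤ c → (∀ i, |L i x| ≤ c * |L i y|) → ‖x‖ ≤ c * ‖y‖ := by
  set e := hA.isSymmetric.eigenvectorBasis rfl with he
  refine ⟨_, fun i => innerSL ℝ (e i), hA.isSymmetric.eigenvalues rfl, fun i =>
    ⟨hA.nonneg_eigenvalues rfl i, fun x => ?_⟩, fun c x y hc h =>
      norm_le_of_forall_abs_inner_le e hc h⟩
  have := hA.isSymmetric.eigenvectorBasis_apply_self_apply rfl x i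
  rw [OrthonormalBasis.repr_apply_apply, OrthonormalBasis.repr_apply_apply] at this
  exact this

theorem exists_eigenmodes {d : ℕ} {Ω : Set (EuclideanSpace ℝ (Fin d))} (𝒯 : Triangulation Ω) :
    ∃ (n : ℕ) (L : Fin n → feSpace 𝒯 →L[ℝ] ℝ) (l : Fin n → ℝ),
      (∀ i, 0 ≤ l i ∧ ∀ x, L i (discreteNegLaplacian 𝒯 x) = l i * L i x) ∧
      ∀ (c : ℝ) (x y : feSpace 𝒯), 0 ≤ c → (∀ i, |L i x| ≤ c * |L i y|) → ‖x‖ ≤ c * ‖y‖ :=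
  exists_eigenfunctionals
    (ContinuousLinearMap.isPositive_adjoint_comp_self (feGrad 𝒯)).toLinearMap

theorem IsL1Solution.isSummedSol {d : ℕ} {Ω : Set (EuclideanSpace ℝ (Fin d))}
    {𝒯 : Triangulation Ω} {α τ : ℝ} {N : ℕ} {vh : feSpace 𝒯} {U : ℕ → feSpace 𝒯}
    (hU : IsL1Solution 𝒯 α τ N (fun _ => 0) vh U) {L : feSpace 𝒯 →L[ℝ] ℝ} {l : ℝ}
    (hL : ∀ x, L (discreteNegLaplacian 𝒯 x) = l * L x) :
    IsSummedSol α (l * τ ^ α) N fun n => L (U n) := by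
  refine isSummedSol_of_step fun n h1 h2 => ?_
  have := congrArg L (hU.step n h1 h2)
  simp only [map_zero, smul_zero, add_zero, map_add, map_smul, map_sum, smul_eq_mul, hL] at this
  rw [← this]
  ring

theorem IsSemidiscreteSolution.isIntegratedSol {d : ℕ} {Ω : Set (EuclideanSpace ℝ (Fin d))}
    {𝒯 : Triangulation Ω} {α T : ℝ} (hα0 : 0 < α) (hα1 : α < 1) (hT : 0 < T) {vh : feSpace 𝒯}
    {u : ℝ → feSpace 𝒯} (hu : IsSemidiscreteSolution 𝒯 α T (fun _ => 0) vh u)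
    {L : feSpace 𝒯 →L[ℝ] ℝ} {l : ℝ} (hL : ∀ x, L (discreteNegLaplacian 𝒯 x) = l * L x) :
    IsIntegratedSol α l T (fun t => L (u t)) ∧
      ∃ V, IsVariationBound T (fun t => L (u t)) V := by
  have hc : ContinuousOn (fun t => L (u t)) (Icc 0 T) :=
    L.continuous.comp_continuousOn hu.continuousOn
  have hd : ∀ s ∈ Ioo 0 T, HasDerivAt (fun t => L (u t)) (L (deriv u s)) s := fun s hs =>
    L.hasFDerivAt.comp_hasDerivAt s
      ((hu.differentiableOn s hs).differentiableAt (Ioo_mem_nhds hs.1 hs.2)).hasDerivAt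
  have hfun : ∀ t s : ℝ, L ((t - s) ^ (-α) • deriv u s) = (t - s) ^ (-α) * L (deriv u s) :=
    fun t s => by rw [map_smul, smul_eq_mul]
  have hi : ∀ t ∈ Ioc 0 T,
      IntervalIntegrable (fun s => (t - s) ^ (-α) * L (deriv u s)) volume 0 t := fun t ht => by
    simp only [← hfun]
    have := hu.integrable t ht
    exact ⟨L.integrable_comp this.1, L.integrable_comp this.2⟩
  refine ⟨isIntegratedSol_of_caputo hα0 hα1 hc hd hi fun t ht => ?_,
    exists_isVariationBound hc hd
      (intervalIntegrable_of_mul_rpow hα0 hT (hi T ⟨hT, le_rfl⟩)) hT⟩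
  have := congrArg L (hu.equation t ht)
  rw [map_add, caputoDeriv, map_smul, ← L.intervalIntegral_comp_comm (hu.integrable t ht)] at this
  simpa only [hfun, map_zero, smul_eq_mul, hL] using this

theorem norm_projL2_le {d : ℕ} {Ω : Set (EuclideanSpace ℝ (Fin d))} (𝒯 : Triangulation Ω)
    (v : L2 Ω) : ‖projL2 𝒯 v‖ ≤ ‖v‖ :=
  Submodule.norm_orthogonalProjectionOnto_apply_le _ v

theorem IsL1Solution.norm_le {d : ℕ} {Ω : Set (EuclideanSpace ℝ (Fin d))}
    {𝒯 : Triangulation Ω} {α τ : ℝ} (hα0 : 0 < α) (hα1 : α < 1) (hτ : 0 < τ) {N : ℕ}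
    {vh : feSpace 𝒯} {U : ℕ → feSpace 𝒯} (hU : IsL1Solution 𝒯 α τ N (fun _ => 0) vh U) {n : ℕ}
    (hn : n ≤ N) : ‖U n‖ ≤ ‖vh‖ := by
  obtain ⟨m, L, l, hL, hnorm⟩ := exists_eigenmodes 𝒯
  have hmode : ∀ i, |L i (U n)| ≤ 1 * |L i vh| := fun i => by
    have hμ : 0 ≤ l i * τ ^ α := mul_nonneg (hL i).1 (by positivity)
    have h := (hU.isSummedSol (hL i).2).eq_mul_discreteSol hα0 hα1 hμ hn
    rw [hU.initial] at h
    rw [h, abs_mul, mul_comm, abs_of_nonneg (discreteSol_nonneg hα0 hα1 hμ n)]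
    exact mul_le_mul_of_nonneg_right (discreteSol_le_one hα0 hα1 hμ n) (abs_nonneg _)
  have h := hnorm 1 (U n) vh zero_le_one hmode
  rwa [one_mul] at h

theorem IsL1Solution.norm_error_le {d : ℕ} {Ω : Set (EuclideanSpace ℝ (Fin d))}
    {𝒯 : Triangulation Ω} {α T τ : ℝ} (hα0 : 0 < α) (hα1 : α < 1) (hτ : 0 < τ) {N : ℕ}
    (hN : N * τ = T) (hT : 0 < T) {vh : feSpace 𝒯} {U : ℕ → feSpace 𝒯}
    (hU : IsL1Solution 𝒯 α τ N (fun _ => 0) vh U) {u : ℝ → feSpace 𝒯}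
    (hu : IsSemidiscreteSolution 𝒯 α T (fun _ => 0) vh u) {k : ℕ} (hk : k < N) :
    ‖u ((k + 1 : ℕ) * τ) - U (k + 1)‖ ≤ errorConst α / (k + 1) * ‖vh‖ := by
  obtain ⟨m, L, l, hL, hnorm⟩ := exists_eigenmodes 𝒯
  have hc := one_le_errorConst hα0 hα1
  have hk0 : (0 : ℝ) < k + 1 := by positivity
  refine hnorm _ _ _ (by positivity) fun i => ?_
  have hμ : 0 ≤ l i * τ ^ α := mul_nonneg (hL i).1 (by positivity)
  obtain ⟨hw, V, hV⟩ := hu.isIntegratedSol hα0 hα1 hT (hL i).2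
  have h := mul_abs_error_le hα0 hα1 hμ (hw.comp_mul hτ hN) (hV.comp_mul hτ hN)
    (hU.isSummedSol (hL i).2) (by rw [hU.initial, mul_zero, hu.initial]) hk
  rw [mul_zero, hu.initial] at h
  rw [map_sub, div_mul_eq_mul_div, le_div_iff₀' hk0, mul_comm _ τ]
  push_cast
  exact h

end

end L1Scheme

end

theorem mainTheorem2 (α : ℝ) (hα0 : 0 < α) (hα1 : α < 1) :
    ∃ c : ℝ, ∀ (d : ℕ), 1 ≤ d → d ≤ 3 →
      ∀ (Ω : Set (EuclideanSpace ℝ (Fin d))), L1Scheme.IsConvexPolygonalDomain Ω →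
      ∀ (𝒯 : L1Scheme.Triangulation Ω) (T : ℝ), 0 < T → ∀ (N : ℕ), 1 ≤ N →
      ∀ (τ : ℝ), τ = T / N →
      ∀ (v : L1Scheme.L2 Ω) (U : ℕ → L1Scheme.feSpace 𝒯),
        L1Scheme.IsL1Solution 𝒯 α τ N (fun _ => 0) (L1Scheme.projL2 𝒯 v) U →
        (∀ u : ℝ → L1Scheme.feSpace 𝒯,
          L1Scheme.IsSemidiscreteSolution 𝒯 α T (fun _ => 0) (L1Scheme.projL2 𝒯 v) u →
          ∀ n : ℕ, 1 ≤ n → n ≤ N →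
            ‖u (n * τ) - U n‖ ≤ c * τ * (n * τ)⁻¹ * ‖v‖) ∧
        (∀ n : ℕ, n ≤ N → ‖U n‖ ≤ c * ‖v‖) := by
  have hc := L1Scheme.one_le_errorConst hα0 hα1
  refine ⟨L1Scheme.errorConst α, fun d _ _ Ω _ 𝒯 T hT N hN τ hτ v U hU => ?_⟩
  have hN0 : (0 : ℝ) < N := by exact_mod_cast hN
  have hτ0 : 0 < τ := by rw [hτ]; positivity
  have hS : (N : ℝ) * τ = T := by rw [hτ]; field_simp
  have hv := L1Scheme.norm_projL2_le 𝒯 v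
  refine ⟨fun u hu n h1 hn => ?_, fun n hn => ?_⟩
  · obtain ⟨k, rfl⟩ : ∃ k, n = k + 1 := ⟨n - 1, by omega⟩
    refine (hU.norm_error_le hα0 hα1 hτ0 hS hT hu hn).trans ?_
    have h2 : L1Scheme.errorConst α * τ * (((k + 1 : ℕ) : ℝ) * τ)⁻¹ =
        L1Scheme.errorConst α / (k + 1) := by
      push_cast; field_simp
    rw [h2]
    exact mul_le_mul_of_nonneg_left hv (by positivity)
  · exact ((hU.norm_le hα0 hα1 hτ0 hn).trans hv).trans
      (le_mul_of_one_le_left (norm_nonneg v) hc)
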